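/- Let $\mathcal M$ be a von Neumann algebra acting on a Hilbert space $\mathbb H$, with a normal semifinite faithful trace $\tau$. Let $m$ be normalized Lebesgue measure on the unit circle $\mathbb T$, let $\mathbb D$ be the unit disc, and let $P_z(t)=\frac{1-|z|^2}{|1-\bar z t|^2}$ be the Poisson kernel. Let $\mathcal S$ be the linear span of the positive elements of $\mathcal M$ whose support projection has finite trace. For a function $\varphi$ put $|\varphi|^2=\varphi^*\varphi$ and $\|\varphi\|_{L^\infty_c}=\big\|\big(\int_{\mathbb T}|\varphi|^2\,dm\big)^{1/2}\big\|_{\mathcal M}$. Let $L^\infty(\mathcal M,L^2_c(\mathbb T))$ be the weak$^*$ closure of the $\mathcal S$-valued simple functions on $\mathbb T$, where a function $\varphi$ is identified with the operator $h\mapsto\varphi(\cdot)h$ from $\mathbb H$ to $L^2(\mathbb T;\mathbb H)$. For $f$ in this space define $$\|f\|_{*,c}=\sup_I\Big\|\Big(\frac1{|I|}\int_I|f-f_I|^2\,dm\Big)^{1/2}\Big\|_{\mathcal M},\qquad f_I=\frac1{|I|}\int_I f\,dm,\quad |I|=m(I),$$ the supremum being over all subarcs $I$ of $\mathbb T$ of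 positive length, and let $f(z)=\int_{\mathbb T}P_z f\,dm$ for $z\in\mathbb D$ be its Poisson integral. Let $\mathcal H(\mathbb D,\mathcal M)$ be the set of all functions $g(z)=\sum_{n\ge0}a_nz^n$ on $\mathbb D$ with $a_n\in\mathcal M$, the series converging in norm for every $z\in\mathbb D$. Let $\mathrm{BMOA}_c(\mathbb T,\mathcal M)$ be the set of all $f\in L^\infty(\mathcal M,L^2_c(\mathbb T))$ with $\|f\|_{*,c}<\infty$ whose Poisson integral belongs to $\mathcal H(\mathbb D,\mathcal M)$. For such $f$ let $$M_f=\{g\in\mathcal H(\mathbb D,\mathcal M):\ g=f\circ\psi-f\circ\psi(0),\ \psi\in\mathrm{Aut}(\mathbb D)\},$$ where $\mathrm{Aut}(\mathbb D)$ is the group of Möbius automorphisms of $\mathbb D$, put $g_\gamma(z)=g(\gamma z)$ for $0<\gamma<1$, and put $$\|f\|_{**,c}=\sup_{z\in\mathbb D}\Big\|\Big(\int_{\mathbb T}|f-f(z)|^2P_z\,dm\Big)^{1/2}\Big\|_{\mathcal M}.$$ **Proposition.** There is an absolute constant $C>0$ such that, for all $\mathbb H$, $\mathcal M$, $\tau$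 as above and every $f\in\mathrm{BMOA}_c(\mathbb T,\mathcal M)$, $$C^{-1}\|f\|_{*,c}\le\sup_{g\in M_f}\ \sup_{0<\gamma<1}\|g_\gamma\|_{L^\infty_c}\le C\|f\|_{*,c}$$ and $$C^{-1}\sup_{g\in M_f}\ \sup_{0<\gamma<1}\|g_\gamma\|_{L^\infty_c}\le\|f\|_{**,c}\le C\sup_{g\in M_f}\ \sup_{0<\gamma<1}\|g_\gamma\|_{L^\infty_c}.$$ -/

import Mathlib

open MeasureTheory Complex.UnitDisc
open scoped ENNReal NNReal InnerProductSpace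

universe u

noncomputable section

namespace OpBMO

/-! ### The unit circle with normalized Lebesgue measure -/

instance instMeasurableSpaceCircle : MeasurableSpace Circle := borel Circle

instance instBorelSpaceCircle : BorelSpace Circle := ⟨rfl⟩

/-- The normalized Lebesgue measure `dm = dθ / 2π` on the unit circle. -/
def m : Measure Circle :=
  (ENNReal.ofReal (2 * Real.pi))⁻¹ •
    (volume.restrict (Set.Ioc (0 : ℝ) (2 * Real.pi))).map Circle.exp

instance instIsProbabilityMeasure_m : IsProbabilityMeasure m := by
  constructor
  have h : 0 < 2 * Real.pi := by positivity
  rw [m, Measure.smul_apply, Measure.map_apply Circle.exp.continuous.measurable MeasurableSet.univ]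
  simp only [Set.preimage_univ, Measure.restrict_apply_univ, Real.volume_Ioc, sub_zero,
    smul_eq_mul]
  exact ENNReal.inv_mul_cancel (by simpa using h) ENNReal.ofReal_ne_top

/-- The subarc `{exp (iθ) : α ≤ θ ≤ β}` of the circle. It is used for `α < β ≤ α + 2π`; the choice
`β = α + 2π` gives the whole circle. Whether the end points belong to the arc is immaterial for
the integrals below. -/
def arc (α β : ℝ) : Set Circle := Circle.exp '' Set.Icc α β

theorem measurableSet_arc (α β : ℝ) : MeasurableSet (arc α β) :=
  (isCompact_Icc.image Circle.exp.continuous).isClosed.measurableSet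

/-- The Poisson kernel `P_z(t) = (1 - |z|²) / |1 - z̄ t|²`, for `z` in the disc and `t` on the
circle. -/
def poisson (z : 𝔻) (t : Circle) : ℝ :=
  (1 - ‖(z : ℂ)‖ ^ 2) / ‖1 - (starRingEnd ℂ) (z : ℂ) * (t : ℂ)‖ ^ 2

theorem continuous_poisson (z : 𝔻) : Continuous (poisson z) := by
  unfold poisson
  refine Continuous.div (by fun_prop) (by fun_prop) fun t => ?_
  have h1 : ‖(starRingEnd ℂ) (z : ℂ) * (t : ℂ)‖ < 1 := by
    simpa [Circle.norm_coe] using z.norm_lt_one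
  have h2 : (1 : ℂ) - (starRingEnd ℂ) (z : ℂ) * (t : ℂ) ≠ 0 := by
    intro h
    rw [← sub_eq_zero.mp h] at h1
    simp at h1
  positivity

/-! ### Bounded scalar weights on the circle -/

/-- The characteristic function of the arc `arc α β`, as an element of `L^∞(𝕋)`. -/
def arcWeight (α β : ℝ) : Lp ℂ ∞ m :=
  indicatorConstLp ∞ (measurableSet_arc α β) (measure_ne_top m _) (1 : ℂ)

theorem memLp_poisson (z : 𝔻) : MemLp (fun t => (poisson z t : ℂ)) ∞ m := by
  have hc : Continuous fun t => (poisson z t : ℂ) :=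
    Complex.continuous_ofReal.comp (continuous_poisson z)
  obtain ⟨C, hC⟩ := isCompact_univ.exists_bound_of_continuousOn hc.continuousOn
  exact memLp_top_of_bound hc.aestronglyMeasurable C
    (Filter.Eventually.of_forall fun t => hC t (Set.mem_univ t))

/-- The Poisson kernel `P_z`, as an element of `L^∞(𝕋)`. -/
def poissonWeight (z : 𝔻) : Lp ℂ ∞ m := (memLp_poisson z).toLp _

/-! ### Von Neumann algebras with a trace -/

section Trace

variable {H : Type u} [NormedAddCommGroup H] [InnerProductSpace ℂ H] [CompleteSpace H]

/-- A normal semifinite faithful trace on the von Neumann algebra `M` acting on `H`. The values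
of `τ` outside the positive part of `M` play no role. The order on operators is the usual order
of self-adjoint operators. -/
structure NSFTrace (M : VonNeumannAlgebra H) where
  τ : (H →L[ℂ] H) → ℝ≥0∞
  map_add : ∀ x ∈ M, ∀ y ∈ M, 0 ≤ x → 0 ≤ y → τ (x + y) = τ x + τ y
  map_smul : ∀ c : ℝ≥0, ∀ x ∈ M, 0 ≤ x → τ (((c : ℝ) : ℂ) • x) = c * τ x
  tracial : ∀ x ∈ M, τ (star x * x) = τ (x * star x)
  normal : ∀ D : Set (H →L[ℂ] H), D.Nonempty → DirectedOn (· ≤ ·) D → (∀ d ∈ D, d ∈ M ∧ 0 ≤ d) →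
    ∀ x ∈ M, IsLUB D x → τ x = ⨆ d ∈ D, τ d
  semifinite : ∀ x ∈ M, 0 ≤ x → x ≠ 0 → ∃ y ∈ M, 0 ≤ y ∧ y ≠ 0 ∧ y ≤ x ∧ τ y < ∞
  faithful : ∀ x ∈ M, 0 ≤ x → x ≠ 0 → 0 < τ x

/-- `p` is the support of `x`: the least projection `p` in `M` with `p x = x`. -/
def IsSupport (M : VonNeumannAlgebra H) (x p : H →L[ℂ] H) : Prop :=
  (p ∈ M ∧ IsStarProjection p ∧ p * x = x) ∧
    ∀ q ∈ M, IsStarProjection q → q * x = x → p ≤ q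

/-- The set `S₊` of positive elements of `M` whose support has finite trace. -/
def finSuppPos {M : VonNeumannAlgebra H} (τ : NSFTrace M) : Set (H →L[ℂ] H) :=
  {x | x ∈ M ∧ 0 ≤ x ∧ ∃ p, IsSupport M x p ∧ τ.τ p < ∞}

/-- The linear span `S` of `S₊`. -/
def finSupp {M : VonNeumannAlgebra H} (τ : NSFTrace M) : Submodule ℂ (H →L[ℂ] H) :=
  Submodule.span ℂ (finSuppPos τ)

end Trace

/-! ### The column space `L^∞(M; L²_c(𝕋))`

An element of `M ⊗ B(L²(𝕋))` in the first column is an operator from `H` to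
`H ⊗ L²(𝕋) = L²(𝕋; H)`. A function `φ : 𝕋 → M` is identified with the column operator
`h ↦ φ(·) h`. -/

section Column

variable {H : Type u} [NormedAddCommGroup H] [InnerProductSpace ℂ H] [CompleteSpace H]

/-- Column operators `H → L²(𝕋; H)`. -/
abbrev Col (H : Type u) [NormedAddCommGroup H] [InnerProductSpace ℂ H] [CompleteSpace H] :
    Type u :=
  H →L[ℂ] Lp H 2 m

/-- The column operator `h ↦ φ(·) h` of an operator-valued function `φ` in `L²(𝕋; B(H))`, in
particular of a simple or a continuous one. -/
def colOf (φ : Lp (H →L[ℂ] H) 2 m) : Col H :=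
  LinearMap.mkContinuous
    { toFun := fun h => (ContinuousLinearMap.apply ℂ H h).compLp φ
      map_add' := fun h k => by
        rw [map_add, ContinuousLinearMap.add_compLp]
      map_smul' := fun c h => by
        rw [map_smul, ContinuousLinearMap.smul_compLp, RingHom.id_apply] }
    ‖φ‖ (fun h => by
      refine (ContinuousLinearMap.norm_compLp_le _ _).trans ?_
      rw [mul_comm]
      refine mul_le_mul_of_nonneg_left ?_ (norm_nonneg _)
      exact ContinuousLinearMap.opNorm_le_bound _ (norm_nonneg _) fun A => by
        simpa [mul_comm] using A.le_opNorm h)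

/-- The constant function with value `a`, as a column operator. -/
def constCol (a : H →L[ℂ] H) : Col H :=
  (Lp.constL 2 m ℂ : H →L[ℂ] Lp H 2 m) ∘L a

/-- The weak-* (σ-weak) topology on the bounded operators between two Hilbert spaces, generated by
the functionals `T ↦ ∑ₙ ⟪ηₙ, T ξₙ⟫` with `∑ ‖ξₙ‖² < ∞` and `∑ ‖ηₙ‖² < ∞`. -/
abbrev sigmaWeak (H K : Type u) [NormedAddCommGroup H] [InnerProductSpace ℂ H]
    [NormedAddCommGroup K] [InnerProductSpace ℂ K] : TopologicalSpace (H →L[ℂ] K) :=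
  ⨅ (ξ : lp (fun _ : ℕ => H) 2) (η : lp (fun _ : ℕ => K) 2),
    TopologicalSpace.induced (fun T : H →L[ℂ] K => ∑' n, ⟪η n, T (ξ n)⟫_ℂ) inferInstance

/-- The column operators of simple functions on the circle with values in `S`. -/
def simpleCols {M : VonNeumannAlgebra H} (τ : NSFTrace M) : Set (Col H) :=
  {T | ∃ φ : SimpleFunc Circle (H →L[ℂ] H), (∀ t, φ t ∈ finSupp τ) ∧
    T = colOf ((φ.memLp_of_isFiniteMeasure 2 m).toLp φ)}

/-- `L^∞(M; L²_c(𝕋))`: the weak-* closure of the `S`-valued simple functions. -/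
def LinftyCol {M : VonNeumannAlgebra H} (τ : NSFTrace M) : Set (Col H) :=
  @closure _ (sigmaWeak H (Lp H 2 m)) (simpleCols τ)

/-- Multiplication by a bounded scalar function `w` on `L²(𝕋; H)`. -/
def mulL (w : Lp ℂ ∞ m) : Lp H 2 m →L[ℂ] Lp H 2 m :=
  (ContinuousLinearMap.lsmul ℂ ℂ : ℂ →L[ℂ] H →L[ℂ] H).holderL m ∞ 2 2 w

/-- The integral `u ↦ ∫ u dm`, from `L²(𝕋; H)` to `H`. -/
def integralL : Lp H 2 m →L[ℂ] H :=
  (L1.integralCLM' ℂ : Lp H 1 m →L[ℂ] H) ∘L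
    (ContinuousLinearMap.lsmul ℂ ℂ : ℂ →L[ℂ] H →L[ℂ] H).holderL m 2 2 1 (Lp.constL 2 m ℂ (1 : ℂ))

theorem integralL_apply (u : Lp H 2 m) : integralL u = ∫ t, u t ∂m := by
  rw [integralL, ContinuousLinearMap.comp_apply]
  change L1.integralCLM' ℂ ((ContinuousLinearMap.lsmul ℂ ℂ : ℂ →L[ℂ] H →L[ℂ] H).holder 1 _ u) = _
  rw [← L1.integral_eq', L1.integral_eq_integral]
  refine integral_congr_ae ?_
  filter_upwards [ContinuousLinearMap.coeFn_holder (r := 1)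
    (ContinuousLinearMap.lsmul ℂ ℂ : ℂ →L[ℂ] H →L[ℂ] H) (Lp.constL 2 m ℂ (1 : ℂ)) u,
    Lp.coeFn_const 2 m (1 : ℂ)] with t h1 h2
  rw [h1]
  change (Lp.const 2 m (1 : ℂ)) t • u t = u t
  rw [h2]
  simp

/-- The operator `∫ w f dm`. -/
def wIntegral (w : Lp ℂ ∞ m) (f : Col H) : H →L[ℂ] H :=
  integralL ∘L mulL w ∘L f

/-- The positive operator `∫ |f|² w dm`, where `|f|² = f* f`, for a weight `w ≥ 0`: the pairing
`⟨f, w f⟩ = ∫ f* (w f) dm`. -/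
def wSquare (w : Lp ℂ ∞ m) (f : Col H) : H →L[ℂ] H :=
  f.adjoint ∘L mulL w ∘L f

/-! ### The seminorms -/

/-- The mean value `f_I = (1/|I|) ∫_I f dm` over `I = arc α β`. -/
def arcMean (f : Col H) (α β : ℝ) : H →L[ℂ] H :=
  (((m.real (arc α β))⁻¹ : ℝ) : ℂ) • wIntegral (arcWeight α β) f

/-- The seminorm `‖f‖_{*,c} = sup_I ‖((1/|I|) ∫_I |f - f_I|² dm)^{1/2}‖`, possibly infinite. -/
def starNorm (f : Col H) : ℝ≥0∞ :=
  ⨆ (α : ℝ) (β : ℝ) (_ : α < β ∧ β ≤ α + 2 * Real.pi),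
    ‖CFC.sqrt ((((m.real (arc α β))⁻¹ : ℝ) : ℂ) •
      wSquare (arcWeight α β) (f - constCol (arcMean f α β)))‖ₑ

/-- The Poisson integral `f(z) = ∫ P_z f dm`. -/
def poissonInt (f : Col H) (z : 𝔻) : H →L[ℂ] H :=
  wIntegral (poissonWeight z) f

/-- The Garsia norm `‖f‖_{**,c} = sup_z ‖(∫ |f - f(z)|² P_z dm)^{1/2}‖`, possibly infinite. -/
def garsiaNorm (f : Col H) : ℝ≥0∞ :=
  ⨆ z : 𝔻, ‖CFC.sqrt (wSquare (poissonWeight z) (f - constCol (poissonInt f z)))‖ₑ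

/-- The norm `‖φ‖_{L^∞_c} = ‖(∫ |φ|² dm)^{1/2}‖` of a function `φ : 𝕋 → B(H)`. It is used for
norm-continuous functions only, for which the integral is a Bochner integral. -/
def linftyColNorm (φ : Circle → (H →L[ℂ] H)) : ℝ≥0∞ :=
  ‖CFC.sqrt (∫ t, star (φ t) * φ t ∂m)‖ₑ

/-! ### Analytic functions and `BMOA_c` -/

/-- The class `H(𝔻, M)` of the sums on `𝔻` of norm convergent power series with coefficients
in `M`. -/
def analyticOn (M : VonNeumannAlgebra H) : Set (𝔻 → (H →L[ℂ] H)) :=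
  {F | ∃ a : ℕ → (H →L[ℂ] H), (∀ n, a n ∈ M) ∧
    ∀ z : 𝔻, HasSum (fun n => (z : ℂ) ^ n • a n) (F z)}

/-- `BMOA_c(𝕋, M)`: the elements `f` of `L^∞(M; L²_c(𝕋))` with `‖f‖_{*,c} < ∞` whose Poisson
integral is analytic. -/
def BMOAc {M : VonNeumannAlgebra H} (τ : NSFTrace M) : Set (Col H) :=
  {f | f ∈ LinftyCol τ ∧ starNorm f < ∞ ∧ poissonInt f ∈ analyticOn M}

/-- The Möbius group `Aut(𝔻)`: the maps `z ↦ e^{iθ} (z - z₀) / (1 - z̄₀ z)`. -/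
def mobius : Set (𝔻 → 𝔻) :=
  {ψ | ∃ (θ : ℝ) (z₀ : 𝔻), ∀ z : 𝔻, (ψ z : ℂ) =
    Complex.exp (Complex.I * θ) * ((z - z₀ : ℂ) / (1 - (starRingEnd ℂ) (z₀ : ℂ) * z))}

/-- The set `M_f` of the functions in `H(𝔻, M)` of the form `f ∘ ψ - f ∘ ψ(0)`, with `ψ` a Möbius
transformation. -/
def translates (M : VonNeumannAlgebra H) (f : Col H) : Set (𝔻 → (H →L[ℂ] H)) :=
  {g | g ∈ analyticOn M ∧ ∃ ψ ∈ mobius, g = fun z => poissonInt f (ψ z) - poissonInt f (ψ 0)}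

/-- The boundary values `t ↦ g_γ(t) = g(γ t)` on the circle of the dilated function `g_γ`,
for `0 < γ < 1`. -/
def dilate (g : 𝔻 → (H →L[ℂ] H)) (γ : Set.Ioo (0 : ℝ) 1) (t : Circle) : H →L[ℂ] H :=
  g (Complex.UnitDisc.mk ((γ : ℝ) * (t : ℂ))
    (by simpa [abs_of_pos γ.2.1, Circle.norm_coe] using γ.2.2))

/-- The quantity `sup_{g ∈ M_f} sup_{0 < γ < 1} ‖g_γ‖_{L^∞_c}`, possibly infinite. -/
def translateNorm (M : VonNeumannAlgebra H) (f : Col H) : ℝ≥0∞ :=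
  ⨆ g ∈ translates M f, ⨆ γ : Set.Ioo (0 : ℝ) 1, linftyColNorm (dilate g γ)

end Column

/-- `X ≍ Y` with constant `C`. -/
def AsympWith (C : ℝ≥0) (X Y : ℝ≥0∞) : Prop :=
  (C : ℝ≥0∞)⁻¹ * X ≤ Y ∧ Y ≤ C * X

end OpBMO

end

namespace OpBMO

open Filter Topology

/-! Since `‖√A h‖² = ⟪h, A h⟫` for `A ≥ 0`, each of the three operator norms is at most `B` exactly
when, for every `h`, certain mean squares of the vector function `u = f h` in `L²(𝕋; H)` are at most
`B² ‖h‖²` (`starNorm_le_iff`, `garsiaNorm_le_iff`, `translateNorm_le_iff`). What remains are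
inequalities for a single Hilbert space valued `u`, with constants independent of `u`.

Arcs against Poisson kernels: a weighted mean minimizes the weighted square deviation
(`weighted_variance_add`), so a pointwise bound between two weights yields a bound between their
variances. The density `|I|⁻¹ 1_I` is dominated by the Poisson kernel of the point at distance `|I|`
from the circle over the centre of `I`. Conversely, `P_z` is dominated by a geometrically weighted
sum of concentric dyadic arc densities; the decay of the weights beats the drift of the means from
one arc to the next (`stepKernel_variance_le`).

Translates against Poisson kernels: the kernels `P_{ψ(γt)}` average over `t` to `P_{ψ(0)}`, so
Jensen's inequality bounds the mean square of `g_γ` by the variance for `P_{ψ(0)}`. As `γ → 1` the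
points `ψ(γt)` reach the circle, the kernels concentrate, and for continuous functions the loss in
Jensen's inequality vanishes. Density of continuous functions in `L²` gives the converse up to a
factor (`poisson_variance_le_of_forall_integral_le`), because every point of the disc is some
`ψ(0)`. -/

/-! ### Normalized length of arcs -/

theorem m_apply {s : Set Circle} (hs : MeasurableSet s) (a : ℝ) :
    m s = (ENNReal.ofReal (2 * Real.pi))⁻¹ *
      volume (Circle.exp ⁻¹' s ∩ Set.Ioc a (a + 2 * Real.pi)) := by
  have hp : MeasurableSet (Circle.exp ⁻¹' s) := Circle.exp.continuous.measurable hs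
  rw [m, Measure.smul_apply, Measure.map_apply Circle.exp.continuous.measurable hs,
    Measure.restrict_apply hp, smul_eq_mul]
  congr 1
  have h0 := isAddFundamentalDomain_Ioc Real.two_pi_pos 0
  rw [zero_add] at h0
  refine h0.measure_set_eq (isAddFundamentalDomain_Ioc Real.two_pi_pos a) hp ?_
  rintro ⟨g, hg⟩
  obtain ⟨n, rfl⟩ := AddSubgroup.mem_zmultiples_iff.1 hg
  ext x
  have : Circle.exp (n • (2 * Real.pi) + x) = Circle.exp x := by
    rw [add_comm]; exact (Circle.periodic_exp.zsmul n) x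
  simp only [Set.mem_preimage, AddSubgroup.mk_vadd, vadd_eq_add, this]

theorem m_arc {α β : ℝ} (h : α < β) (h' : β ≤ α + 2 * Real.pi) :
    m.real (arc α β) = (β - α) / (2 * Real.pi) := by
  have hv : volume (Circle.exp ⁻¹' arc α β ∩ Set.Ioc α (α + 2 * Real.pi)) =
      volume (Set.Ioc α β) := by
    apply measure_congr
    -- For the full circle both end points are the same point of the arc; discarding one parameter
    -- value makes `Circle.exp` injective on what is left.
    have hne : ∀ᵐ x : ℝ, x ≠ α + 2 * Real.pi := Measure.ae_ne volume _
    filter_upwards [hne] with x hx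
    refine propext ⟨?_, ?_⟩
    · rintro ⟨⟨y, hy, hxy⟩, hx1, hx2⟩
      refine ⟨hx1, ?_⟩
      have hx2' : x < α + 2 * Real.pi := lt_of_le_of_ne hx2 hx
      have h0 : Real.pi > 0 := Real.pi_pos
      rcases eq_or_lt_of_le hy.2 with rfl | hlt
      · rcases eq_or_lt_of_le h' with h'' | h''
        · rw [h'']; exact hx2
        · exact (Circle.exp_injOn_Ico (a := α) (b := α + 2 * Real.pi) (by linarith)
            ⟨hy.1, h''⟩ ⟨hx1.le, hx2'⟩ hxy).ge
      · have := Circle.exp_injOn_Ico (a := α) (b := α + 2 * Real.pi) (by linarith)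
          ⟨hy.1, by linarith⟩ ⟨hx1.le, hx2'⟩ hxy
        linarith
    · rintro ⟨hx1, hx2⟩
      exact ⟨⟨x, ⟨hx1.le, hx2⟩, rfl⟩, hx1, hx2.trans h'⟩
  rw [Measure.real, m_apply (measurableSet_arc α β) α, hv, Real.volume_Ioc, ENNReal.toReal_mul,
    ENNReal.toReal_inv, ENNReal.toReal_ofReal Real.two_pi_pos.le,
    ENNReal.toReal_ofReal (sub_pos.2 h).le]
  ring

/-! ### Mean value property and the Poisson kernel -/

theorem integral_m_eq_circleAverage {E : Type*} [NormedAddCommGroup E] [NormedSpace ℝ E]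
    (F : ℂ → E) (hF : Continuous fun t : Circle => F t) :
    ∫ t : Circle, F t ∂m = Real.circleAverage F 0 1 := by
  rw [m, integral_smul_measure, integral_map Circle.exp.continuous.aemeasurable
    hF.aestronglyMeasurable, Real.circleAverage_def,
    intervalIntegral.integral_of_le Real.two_pi_pos.le, ENNReal.toReal_inv,
    ENNReal.toReal_ofReal Real.two_pi_pos.le]
  simp [circleMap]

theorem integral_m_of_diffContOnCl {F : ℂ → ℂ} (hF : DiffContOnCl ℂ F (Metric.ball 0 1)) :
    ∫ t : Circle, F t ∂m = F 0 := by
  rw [integral_m_eq_circleAverage, DiffContOnCl.circleAverage (by simpa using hF)]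
  refine hF.continuousOn.comp_continuous continuous_subtype_val fun t => ?_
  rw [closure_ball _ one_ne_zero]
  simp [Circle.norm_coe]

theorem norm_conj_mul_lt_one (z : 𝔻) {w : ℂ} (hw : ‖w‖ ≤ 1) :
    ‖(starRingEnd ℂ) (z : ℂ) * w‖ < 1 := by
  rw [norm_mul, RCLike.norm_conj]
  exact mul_lt_one_of_nonneg_of_lt_one_left (norm_nonneg _) z.norm_lt_one hw

theorem one_sub_ne_zero_of_norm_lt_one {w : ℂ} (hw : ‖w‖ < 1) : 1 - w ≠ 0 := by
  intro h
  rw [← sub_eq_zero.mp h] at hw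
  simp at hw

theorem re_cayley {a : ℂ} (ha : ‖a‖ < 1) :
    ((1 + a) / (1 - a)).re = (1 - ‖a‖ ^ 2) / ‖1 - a‖ ^ 2 := by
  have h : ‖1 - a‖ ^ 2 ≠ 0 := by
    simpa using one_sub_ne_zero_of_norm_lt_one ha
  rw [Complex.div_re, Complex.sq_norm, Complex.sq_norm] at *
  rw [← add_div]
  congr 1
  simp [Complex.normSq_apply]
  ring

theorem poisson_eq_re (z : 𝔻) (t : Circle) :
    poisson z t = ((1 + (starRingEnd ℂ) (z : ℂ) * t) / (1 - (starRingEnd ℂ) (z : ℂ) * t)).re := by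
  rw [re_cayley (norm_conj_mul_lt_one z (Circle.norm_coe t).le), poisson]
  simp [Circle.norm_coe]

/-- Unlike `poisson_eq_re`, whose quotient is holomorphic in `t`, this form is holomorphic in `z`,
as is needed to average `P_{ψ(t)}` over `t`. -/
theorem poisson_eq_re' (z : 𝔻) (t : Circle) :
    poisson z t = ((1 + (starRingEnd ℂ) (t : ℂ) * z) / (1 - (starRingEnd ℂ) (t : ℂ) * z)).re := by
  rw [re_cayley (by simpa [Circle.norm_coe] using z.norm_lt_one), poisson]
  simp only [norm_mul, RCLike.norm_conj, Circle.norm_coe, one_mul]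
  rw [← RCLike.norm_conj (1 - _)]
  simp [mul_comm]

theorem poisson_pos (z : 𝔻) (t : Circle) : 0 < poisson z t := by
  have h := one_sub_ne_zero_of_norm_lt_one (norm_conj_mul_lt_one z (w := t) (Circle.norm_coe t).le)
  have := z.sq_norm_lt_one
  exact div_pos (by linarith) (by positivity)

/-- The mean value property of the real part of a holomorphic function. -/
theorem integral_re_of_diffContOnCl {F : ℂ → ℂ} (hF : DiffContOnCl ℂ F (Metric.ball 0 1)) :
    ∫ t : Circle, (F t).re ∂m = (F 0).re := by
  have hc : Continuous fun t : Circle => F t := by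
    refine hF.continuousOn.comp_continuous continuous_subtype_val fun t => ?_
    rw [closure_ball _ one_ne_zero]
    simp [Circle.norm_coe]
  rw [← integral_m_of_diffContOnCl hF]
  exact integral_re (𝕜 := ℂ) (hc.integrable_of_hasCompactSupport
    (HasCompactSupport.of_compactSpace _))

theorem diffContOnCl_ball_one {F : ℂ → ℂ} (h : ∀ w, ‖w‖ ≤ 1 → DifferentiableAt ℂ F w) :
    DiffContOnCl ℂ F (Metric.ball 0 1) := by
  refine DifferentiableOn.diffContOnCl ?_
  rw [closure_ball _ one_ne_zero]
  intro w hw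
  exact (h w (by simpa using hw)).differentiableWithinAt

theorem integral_poisson (z : 𝔻) : ∫ t, poisson z t ∂m = 1 := by
  simp_rw [poisson_eq_re]
  have := integral_re_of_diffContOnCl
    (F := fun w => (1 + (starRingEnd ℂ) (z : ℂ) * w) / (1 - (starRingEnd ℂ) (z : ℂ) * w))
    (diffContOnCl_ball_one fun w hw => DifferentiableAt.div (by fun_prop) (by fun_prop)
      (one_sub_ne_zero_of_norm_lt_one (norm_conj_mul_lt_one z hw)))
  simpa using this

/-- If `ψ` is holomorphic on the closed disc with values in the open disc, then the Poisson kernels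
`P_{ψ(t)}` average to `P_{ψ(0)}`. -/
theorem integral_poisson_comp {ψ : ℂ → ℂ} (hψ : ∀ w, ‖w‖ ≤ 1 → DifferentiableAt ℂ ψ w)
    (hψ' : ∀ w, ‖w‖ ≤ 1 → ‖ψ w‖ < 1) {p : Circle → 𝔻} (hp : ∀ t : Circle, (p t : ℂ) = ψ t)
    {z : 𝔻} (hz : (z : ℂ) = ψ 0) (s : Circle) :
    ∫ t, poisson (p t) s ∂m = poisson z s := by
  simp_rw [poisson_eq_re', hp, hz]
  exact integral_re_of_diffContOnCl
    (F := fun w => (1 + (starRingEnd ℂ) (s : ℂ) * ψ w) / (1 - (starRingEnd ℂ) (s : ℂ) * ψ w))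
    (diffContOnCl_ball_one fun w hw => DifferentiableAt.div
      ((hψ w hw).const_mul _ |>.const_add _) ((hψ w hw).const_mul _ |>.const_sub _)
      (one_sub_ne_zero_of_norm_lt_one (by simpa [Circle.norm_coe] using hψ' w hw)))

/-! ### Bounds for the Poisson kernel -/

theorem norm_one_sub_exp_le (x : ℝ) : ‖1 - Complex.exp (x * Complex.I)‖ ≤ |x| := by
  rw [norm_sub_rev, mul_comm]
  simpa using Real.norm_exp_I_mul_ofReal_sub_one_le (x := x)

theorem le_norm_one_sub_exp {x : ℝ} (hx : |x| ≤ Real.pi) :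
    2 * |x| / Real.pi ≤ ‖1 - Complex.exp (x * Complex.I)‖ := by
  rw [norm_sub_rev, mul_comm (x : ℂ), Complex.norm_exp_I_mul_ofReal_sub_one]
  have h1 := Real.mul_abs_le_abs_sin (x := x / 2) (by rw [abs_div]; simp; linarith)
  rw [Real.norm_eq_abs, abs_mul, abs_two]
  rw [abs_div, abs_two] at h1
  calc 2 * |x| / Real.pi = 2 * (2 / Real.pi * (|x| / 2)) := by ring
    _ ≤ _ := by gcongr

/-- The point `(1 - δ) e^{ic}` of the disc. -/
noncomputable def discPoint (δ c : ℝ) (_ : 0 < δ) (h1 : δ ≤ 1) : 𝔻 :=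
  Complex.UnitDisc.mk (((1 - δ : ℝ) : ℂ) * Complex.exp (c * Complex.I)) (by
    rw [norm_mul, Complex.norm_exp_ofReal_mul_I, Complex.norm_real, Real.norm_eq_abs,
      abs_of_nonneg (by linarith)]
    linarith)

theorem exists_eq_discPoint (z : 𝔻) :
    ∃ (δ c : ℝ) (h0 : 0 < δ) (h1 : δ ≤ 1), z = discPoint δ c h0 h1 := by
  refine ⟨1 - ‖(z : ℂ)‖, Complex.arg z, by linarith [z.norm_lt_one],
    by linarith [norm_nonneg (z : ℂ)], ?_⟩
  apply Complex.UnitDisc.coe_injective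
  simp [discPoint]

theorem poisson_discPoint (δ c x : ℝ) (h0 : 0 < δ) (h1 : δ ≤ 1) :
    poisson (discPoint δ c h0 h1) (Circle.exp (c + x)) =
      δ * (2 - δ) / ‖1 - ((1 - δ : ℝ) : ℂ) * Complex.exp (x * Complex.I)‖ ^ 2 := by
  have h : (starRingEnd ℂ) (discPoint δ c h0 h1 : ℂ) * (Circle.exp (c + x) : ℂ) =
      ((1 - δ : ℝ) : ℂ) * Complex.exp (x * Complex.I) := by
    simp only [discPoint, Complex.UnitDisc.coe_mk, map_mul, Complex.conj_ofReal, Circle.coe_exp,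
      ← Complex.exp_conj, Complex.conj_I]
    rw [mul_assoc, ← Complex.exp_add]
    congr 2
    push_cast
    ring
  have hn : ‖(discPoint δ c h0 h1 : ℂ)‖ = 1 - δ := by
    rw [discPoint, Complex.UnitDisc.coe_mk, norm_mul, Complex.norm_exp_ofReal_mul_I,
      Complex.norm_real, Real.norm_eq_abs, abs_of_nonneg (by linarith), mul_one]
  rw [poisson, h, hn]
  congr 1
  ring

theorem le_norm_one_sub_mul_exp {δ x : ℝ} (h1 : δ ≤ 1) :
    δ ≤ ‖1 - ((1 - δ : ℝ) : ℂ) * Complex.exp (x * Complex.I)‖ := by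
  have := norm_sub_norm_le (1 : ℂ) (((1 - δ : ℝ) : ℂ) * Complex.exp (x * Complex.I))
  rw [norm_mul, Complex.norm_exp_ofReal_mul_I, Complex.norm_real, Real.norm_eq_abs,
      abs_of_nonneg (by linarith : (0 : ℝ) ≤ 1 - δ), norm_one] at this
  linarith

theorem norm_one_sub_mul_exp_sub {δ x : ℝ} (h0 : 0 < δ) :
    ‖(1 - Complex.exp (x * Complex.I)) -
      (1 - ((1 - δ : ℝ) : ℂ) * Complex.exp (x * Complex.I))‖ = δ := by
  have : (1 - Complex.exp (x * Complex.I)) -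
      (1 - ((1 - δ : ℝ) : ℂ) * Complex.exp (x * Complex.I)) =
      ((-δ : ℝ) : ℂ) * Complex.exp (x * Complex.I) := by
    push_cast; ring
  rw [this, norm_mul, Complex.norm_exp_ofReal_mul_I, Complex.norm_real, Real.norm_eq_abs, abs_neg,
    abs_of_pos h0, mul_one]

theorem poisson_discPoint_lower {δ x : ℝ} (c : ℝ) (h0 : 0 < δ) (h1 : δ ≤ 1)
    (hx : |x| ≤ Real.pi * δ) :
    δ⁻¹ ≤ 32 * poisson (discPoint δ c h0 h1) (Circle.exp (c + x)) := by
  rw [poisson_discPoint]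
  set N := ‖1 - ((1 - δ : ℝ) : ℂ) * Complex.exp (x * Complex.I)‖ with hN
  have hpos : δ ≤ N := le_norm_one_sub_mul_exp h1
  -- `N ≤ δ + |x|` with `|x| ≤ πδ < 4δ`; then `P ≥ δ / (5δ)²`, and `25 ≤ 32`.
  have hle : N ≤ 5 * δ := by
    have h2 := norm_one_sub_mul_exp_sub (x := x) h0
    have h3 := norm_sub_norm_le (1 - ((1 - δ : ℝ) : ℂ) * Complex.exp (x * Complex.I))
      (1 - Complex.exp (x * Complex.I))
    rw [norm_sub_rev (1 - _) (1 - _), h2] at h3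
    have h4 := norm_one_sub_exp_le x
    have := mul_lt_mul_of_pos_right Real.pi_lt_four h0
    linarith
  have : 0 < N := h0.trans_le hpos
  rw [inv_eq_one_div, ← mul_div_assoc, div_le_div_iff₀ h0 (by positivity)]
  have : N ^ 2 ≤ (5 * δ) ^ 2 := by gcongr
  nlinarith

theorem poisson_discPoint_upper {δ x : ℝ} (c : ℝ) (h0 : 0 < δ) (h1 : δ ≤ 1) (hx : |x| ≤ Real.pi) :
    poisson (discPoint δ c h0 h1) (Circle.exp (c + x)) ≤
      2 * δ / (max δ (|x| / Real.pi)) ^ 2 := by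
  rw [poisson_discPoint]
  have hpos := le_norm_one_sub_mul_exp (x := x) h1
  have h2 := norm_one_sub_mul_exp_sub (x := x) h0
  have h3 := norm_sub_norm_le (1 - Complex.exp (x * Complex.I))
    (1 - ((1 - δ : ℝ) : ℂ) * Complex.exp (x * Complex.I))
  rw [h2] at h3
  have h4 := le_norm_one_sub_exp hx
  have h5 : 2 * |x| / Real.pi = 2 * (|x| / Real.pi) := by ring
  rw [mul_comm 2 δ]
  gcongr
  · linarith
  -- `N ≥ δ` and `N ≥ 2|x|/π - δ` add up to `N ≥ |x|/π`.
  · exact max_le hpos (by linarith)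

/-! ### Weighted variance of a Hilbert space valued function -/

section Variance

variable {X : Type*} [MeasurableSpace X] {μ : Measure X} [IsFiniteMeasure μ]
variable {H : Type*} [NormedAddCommGroup H] [InnerProductSpace ℂ H]

theorem integrable_weight_smul {ρ : X → ℝ} (hρ : MemLp ρ ∞ μ) {u : X → H} (hu : MemLp u 2 μ) :
    Integrable (fun t => ρ t • u t) μ :=
  Integrable.smul_of_top_right (φ := ρ) (f := u) (hu.integrable one_le_two) hρ

omit [InnerProductSpace ℂ H] in
theorem integrable_weight_sq {ρ : X → ℝ} (hρ : MemLp ρ ∞ μ) {u : X → H} (hu : MemLp u 2 μ)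
    (a : H) : Integrable (fun t => ρ t * ‖u t - a‖ ^ 2) μ :=
  (hu.sub (memLp_const a)).integrable_norm_pow two_ne_zero |>.smul_of_top_right hρ

variable [CompleteSpace H]

/-- Pythagoras: `u - c` has `ρ`-weighted mean zero, hence is orthogonal to the constant `c - a`. -/
theorem weighted_variance_add {ρ : X → ℝ} (hρ : MemLp ρ ∞ μ) (h1 : ∫ t, ρ t ∂μ = 1) {u : X → H}
    (hu : MemLp u 2 μ) (a : H) :
    ∫ t, ρ t * ‖u t - a‖ ^ 2 ∂μ =
      ∫ t, ρ t * ‖u t - ∫ s, ρ s • u s ∂μ‖ ^ 2 ∂μ + ‖(∫ s, ρ s • u s ∂μ) - a‖ ^ 2 := by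
  set c := ∫ s, ρ s • u s ∂μ with hc
  have hρi : Integrable ρ μ := hρ.integrable le_top
  have hint : Integrable (fun t => ρ t • (u t - c)) μ :=
    integrable_weight_smul hρ (hu.sub (memLp_const c))
  have h0 : ∫ t, ρ t • (u t - c) ∂μ = 0 := by
    simp_rw [smul_sub]
    rw [integral_sub (integrable_weight_smul hρ hu) (hρi.smul_const c), integral_smul_const, h1,
      one_smul, hc, sub_self]
  have hin : ∫ t, (⟪c - a, ρ t • (u t - c)⟫_ℂ).re ∂μ = 0 := by
    have h2 := integral_re (𝕜 := ℂ) (hint.const_inner (𝕜 := ℂ) (c - a))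
    rw [integral_inner hint (c - a), h0, inner_zero_right] at h2
    simpa only [RCLike.re_to_complex, Complex.zero_re] using h2
  have hpt : ∀ t, ρ t * ‖u t - a‖ ^ 2 = ρ t * ‖u t - c‖ ^ 2 +
      2 * (⟪c - a, ρ t • (u t - c)⟫_ℂ).re + ρ t * ‖c - a‖ ^ 2 := by
    intro t
    have h3 : u t - a = (c - a) + (u t - c) := by abel
    have h4 : (⟪c - a, ρ t • (u t - c)⟫_ℂ).re = ρ t * (⟪c - a, u t - c⟫_ℂ).re := by
      rw [← Complex.coe_smul (ρ t), inner_smul_right, Complex.re_ofReal_mul]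
    have h5 := norm_add_sq (𝕜 := ℂ) (c - a) (u t - c)
    rw [h3, h5, h4]
    simp only [RCLike.re_to_complex]
    ring
  simp_rw [hpt]
  have i2 : Integrable (fun t => 2 * (⟪c - a, ρ t • (u t - c)⟫_ℂ).re) μ :=
    ((hint.const_inner (𝕜 := ℂ) (c - a)).re).const_mul 2
  have i12 : Integrable (fun t => ρ t * ‖u t - c‖ ^ 2 +
      2 * (⟪c - a, ρ t • (u t - c)⟫_ℂ).re) μ := (integrable_weight_sq hρ hu c).add i2
  rw [integral_add i12 (hρi.mul_const _), integral_add (integrable_weight_sq hρ hu c) i2,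
    integral_const_mul, hin, integral_mul_const, h1]
  ring

theorem weighted_variance_le {ρ : X → ℝ} (hρ : MemLp ρ ∞ μ) (h1 : ∫ t, ρ t ∂μ = 1) {u : X → H}
    (hu : MemLp u 2 μ) (a : H) :
    ∫ t, ρ t * ‖u t - ∫ s, ρ s • u s ∂μ‖ ^ 2 ∂μ ≤ ∫ t, ρ t * ‖u t - a‖ ^ 2 ∂μ := by
  rw [weighted_variance_add hρ h1 hu a]
  exact le_add_of_nonneg_right (sq_nonneg _)

theorem norm_weighted_mean_sub_sq_le {ρ : X → ℝ} (hρ : MemLp ρ ∞ μ) (h0 : ∀ t, 0 ≤ ρ t)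
    (h1 : ∫ t, ρ t ∂μ = 1) {u : X → H} (hu : MemLp u 2 μ) (a : H) :
    ‖(∫ s, ρ s • u s ∂μ) - a‖ ^ 2 ≤ ∫ t, ρ t * ‖u t - a‖ ^ 2 ∂μ := by
  rw [weighted_variance_add hρ h1 hu a]
  exact le_add_of_nonneg_left (integral_nonneg fun t => mul_nonneg (h0 t) (sq_nonneg _))

end Variance

/-! ### Normalized weights of arcs -/

/-- The normalized characteristic function `|I|⁻¹ 1_I` of the arc `I = arc α β`. -/
noncomputable def arcDensity (α β : ℝ) : Circle → ℝ :=
  (arc α β).indicator fun _ => (m.real (arc α β))⁻¹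

theorem arcDensity_nonneg (α β : ℝ) (t : Circle) : 0 ≤ arcDensity α β t :=
  Set.indicator_nonneg (fun _ _ => by positivity) t

theorem memLp_arcDensity (α β : ℝ) : MemLp (arcDensity α β) ∞ m :=
  memLp_indicator_const _ (measurableSet_arc α β) _ (Or.inr (measure_ne_top m _))

theorem integral_arcDensity {α β : ℝ} (h : α < β) (h' : β ≤ α + 2 * Real.pi) :
    ∫ t, arcDensity α β t ∂m = 1 := by
  have hm : m.real (arc α β) ≠ 0 := by
    rw [m_arc h h']
    have := Real.pi_pos
    have := sub_pos.2 h
    positivity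
  rw [arcDensity, integral_indicator_const _ (measurableSet_arc α β), smul_eq_mul,
    mul_inv_cancel₀ hm]

theorem memLp_poisson_real (z : 𝔻) : MemLp (poisson z) ∞ m := by
  obtain ⟨C, hC⟩ := isCompact_univ.exists_bound_of_continuousOn (continuous_poisson z).continuousOn
  exact memLp_top_of_bound (continuous_poisson z).aestronglyMeasurable C
    (Filter.Eventually.of_forall fun t => hC t (Set.mem_univ t))

/-! ### Variances over arcs against Poisson variances -/

section Compare

variable {H : Type*} [NormedAddCommGroup H] [InnerProductSpace ℂ H] [CompleteSpace H]

theorem arc_variance_le_of_poisson_variance_le {u : Circle → H} (hu : MemLp u 2 m) {K : ℝ}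
    (hK : ∀ z : 𝔻, ∫ t, poisson z t * ‖u t - ∫ s, poisson z s • u s ∂m‖ ^ 2 ∂m ≤ K)
    {α β : ℝ} (h : α < β) (h' : β ≤ α + 2 * Real.pi) :
    ∫ t, arcDensity α β t * ‖u t - ∫ s, arcDensity α β s • u s ∂m‖ ^ 2 ∂m ≤ 32 * K := by
  have hpi := Real.pi_pos
  have h0 : 0 < (β - α) / (2 * Real.pi) := div_pos (sub_pos.2 h) Real.two_pi_pos
  have h1 : (β - α) / (2 * Real.pi) ≤ 1 := by
    rw [div_le_one Real.two_pi_pos]; linarith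
  -- The point over the centre of the arc with `1 - |z|` equal to the normalized length `δ`; the
  -- half-width of the arc is then `πδ`, the range of `poisson_discPoint_lower`.
  set z := discPoint ((β - α) / (2 * Real.pi)) ((α + β) / 2) h0 h1 with hz
  refine (weighted_variance_le (memLp_arcDensity α β) (integral_arcDensity h h') hu
    (∫ s, poisson z s • u s ∂m)).trans ?_
  refine le_trans ?_ (mul_le_mul_of_nonneg_left (hK z) (by norm_num))
  rw [← integral_const_mul]
  refine integral_mono (integrable_weight_sq (memLp_arcDensity α β) hu _)
    ((integrable_weight_sq (memLp_poisson_real z) hu _).const_mul 32) fun t => ?_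
  dsimp only
  rw [← mul_assoc]
  refine mul_le_mul_of_nonneg_right ?_ (sq_nonneg _)
  refine Set.indicator_apply_le' ?_ fun _ => mul_nonneg (by norm_num) (poisson_pos z t).le
  rintro ⟨θ, hθ, rfl⟩
  have h3 := poisson_discPoint_lower (x := θ - (α + β) / 2) ((α + β) / 2) h0 h1 (by
    have : Real.pi * ((β - α) / (2 * Real.pi)) = (β - α) / 2 := by field_simp
    rw [this, abs_le]
    constructor <;> linarith [hθ.1, hθ.2])
  rw [m_arc h h']
  simpa using h3

/-- The dyadic arc `{e^{i(c + x)} : |x| ≤ 2⁻ᵏ π}` has normalized weight `dyadicDensity c k`. -/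
noncomputable def dyadicDensity (c : ℝ) (k : ℕ) : Circle → ℝ :=
  arcDensity (c - Real.pi * (1 / 2) ^ k) (c + Real.pi * (1 / 2) ^ k)

theorem dyadic_arc_admissible (c : ℝ) (k : ℕ) :
    c - Real.pi * (1 / 2) ^ k < c + Real.pi * (1 / 2) ^ k ∧
      c + Real.pi * (1 / 2) ^ k ≤ c - Real.pi * (1 / 2) ^ k + 2 * Real.pi := by
  have h : 0 < Real.pi * (1 / 2) ^ k := by positivity
  have h2 : Real.pi * (1 / 2) ^ k ≤ Real.pi * 1 :=
    mul_le_mul_of_nonneg_left (pow_le_one₀ (by norm_num) (by norm_num)) Real.pi_pos.le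
  constructor <;> linarith

theorem dyadicDensity_apply {c x : ℝ} {k : ℕ} (hx : |x| ≤ Real.pi * (1 / 2) ^ k) :
    dyadicDensity c k (Circle.exp (c + x)) = 2 ^ k := by
  obtain ⟨h1, h2⟩ := dyadic_arc_admissible c k
  rw [dyadicDensity, arcDensity, Set.indicator_of_mem, m_arc h1 h2]
  · have : (c + Real.pi * (1 / 2) ^ k - (c - Real.pi * (1 / 2) ^ k)) / (2 * Real.pi) =
      (1 / 2) ^ k := by
      have := Real.pi_pos
      field_simp
      ring
    rw [this]
    simp
  · obtain ⟨h3, h4⟩ := abs_le.1 hx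
    exact ⟨c + x, ⟨by linarith, by linarith⟩, rfl⟩

/-- A step function majorant of the Poisson kernel. -/
noncomputable def stepKernel (c : ℝ) : ℕ → Circle → ℝ
  | 0 => dyadicDensity c 0
  | n + 1 => fun t => 1 / 2 * stepKernel c n t + dyadicDensity c (n + 1) t

theorem stepKernel_nonneg (c : ℝ) (n : ℕ) (t : Circle) : 0 ≤ stepKernel c n t := by
  induction n with
  | zero => exact arcDensity_nonneg _ _ t
  | succ n ih =>
    have := arcDensity_nonneg (c - Real.pi * (1 / 2) ^ (n + 1)) (c + Real.pi * (1 / 2) ^ (n + 1)) t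
    rw [stepKernel]
    exact add_nonneg (by linarith) this

theorem dyadicDensity_le_stepKernel (c : ℝ) (n : ℕ) (t : Circle) :
    dyadicDensity c n t ≤ stepKernel c n t := by
  cases n with
  | zero => exact le_rfl
  | succ n =>
    rw [stepKernel]
    linarith [stepKernel_nonneg c n t]

theorem memLp_stepKernel (c : ℝ) (n : ℕ) : MemLp (stepKernel c n) ∞ m := by
  induction n with
  | zero => exact memLp_arcDensity _ _
  | succ n ih => exact (ih.const_mul (1 / 2)).add (memLp_arcDensity _ _)

theorem integral_stepKernel_le (c : ℝ) (n : ℕ) : ∫ t, stepKernel c n t ∂m ≤ 2 := by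
  induction n with
  | zero =>
    obtain ⟨h1, h2⟩ := dyadic_arc_admissible c 0
    have := integral_arcDensity h1 h2
    simp only [stepKernel, dyadicDensity]
    linarith
  | succ n ih =>
    obtain ⟨h1, h2⟩ := dyadic_arc_admissible c (n + 1)
    have := integral_arcDensity h1 h2
    simp only [stepKernel, dyadicDensity]
    rw [integral_add (((memLp_stepKernel c n).integrable le_top).const_mul _)
      ((memLp_arcDensity _ _).integrable le_top), integral_const_mul]
    linarith

/-- Unrolled, the step kernel is the sum over `k ≤ n` of `2^{-(n-k)}` times the `k`-th dyadic
density. Where `|x|/π` is about `2⁻ᵏ`, the `k`-th term is `2^{-(n-k)} 2ᵏ = 2⁻ⁿ 4ᵏ`, which is the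
Poisson decay `2⁻ⁿ / (|x|/π)²`. The factor `4` pays for rounding `|x|/π` to a power of `1/2`. -/
theorem stepKernel_lower {c x : ℝ} (n : ℕ) (hx : |x| ≤ Real.pi) :
    (1 / 2) ^ n ≤ 4 * stepKernel c n (Circle.exp (c + x)) *
      (max (|x| / Real.pi) ((1 / 2) ^ n)) ^ 2 := by
  have hpi := Real.pi_pos
  have key : ∀ k : ℕ, |x| / Real.pi ≤ (1 / 2) ^ k →
      2 ^ k ≤ stepKernel c k (Circle.exp (c + x)) := by
    intro k hk
    rw [div_le_iff₀ hpi, mul_comm] at hk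
    rw [← dyadicDensity_apply (c := c) hk]
    exact dyadicDensity_le_stepKernel c k _
  have hq : ∀ k : ℕ, (2 : ℝ) ^ k * (1 / 2) ^ k = 1 := fun k => by
    rw [← mul_pow]; norm_num
  have hpos : ∀ k : ℕ, 0 < ((1 : ℝ) / 2) ^ k := fun k => by positivity
  have easy : ∀ k : ℕ, |x| / Real.pi ≤ (1 / 2) ^ k →
      (1 / 2) ^ k ≤ 4 * stepKernel c k (Circle.exp (c + x)) *
      (max (|x| / Real.pi) ((1 / 2) ^ k)) ^ 2 := by
    intro k hk
    rw [max_eq_right hk]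
    calc ((1 : ℝ) / 2) ^ k = (2 ^ k * (1 / 2) ^ k) * (1 / 2) ^ k := by rw [hq, one_mul]
      _ = 2 ^ k * ((1 / 2) ^ k) ^ 2 := by ring
      _ ≤ 4 * stepKernel c k (Circle.exp (c + x)) * ((1 / 2) ^ k) ^ 2 := by
        refine mul_le_mul_of_nonneg_right ?_ (sq_nonneg _)
        linarith [key k hk, stepKernel_nonneg c k (Circle.exp (c + x))]
  induction n with
  | zero =>
    refine easy 0 ?_
    rw [pow_zero, div_le_one hpi]; exact hx
  | succ n ih =>
    rcases le_total (|x| / Real.pi) ((1 / 2) ^ (n + 1)) with h1 | h1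
    · exact easy _ h1
    · rw [max_eq_left h1]
      have hstep : stepKernel c n (Circle.exp (c + x)) ≤
          2 * stepKernel c (n + 1) (Circle.exp (c + x)) := by
        have := arcDensity_nonneg (c - Real.pi * (1 / 2) ^ (n + 1))
          (c + Real.pi * (1 / 2) ^ (n + 1)) (Circle.exp (c + x))
        simp only [stepKernel, dyadicDensity]
        linarith
      rcases le_total (|x| / Real.pi) ((1 / 2) ^ n) with h2 | h2
      · have h3 := key n h2
        have h4 : ((1 / 2) ^ (n + 1)) ^ 2 ≤ (|x| / Real.pi) ^ 2 :=
          pow_le_pow_left₀ (hpos _).le h1 2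
        calc ((1 : ℝ) / 2) ^ (n + 1)
            = (2 ^ n * (1 / 2) ^ n) * (1 / 2) ^ (n + 1) := by rw [hq, one_mul]
          _ = 2 * 2 ^ n * ((1 / 2) ^ (n + 1)) ^ 2 := by ring
          _ ≤ 4 * stepKernel c (n + 1) (Circle.exp (c + x)) * (|x| / Real.pi) ^ 2 := by
            refine mul_le_mul (by linarith) h4 (sq_nonneg _) ?_
            exact mul_nonneg (by norm_num) (stepKernel_nonneg _ _ _)
      · rw [max_eq_left h2] at ih
        have h5 := mul_le_mul_of_nonneg_right hstep (sq_nonneg (|x| / Real.pi))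
        rw [pow_succ]
        nlinarith

theorem poisson_le_stepKernel {δ : ℝ} (c : ℝ) (h0 : 0 < δ) (h1 : δ ≤ 1) {n : ℕ}
    (hn : (1 / 2) ^ (n + 1) < δ) (hn' : δ ≤ (1 / 2) ^ n) (t : Circle) :
    poisson (discPoint δ c h0 h1) t ≤ 32 * stepKernel c n t := by
  obtain ⟨x, hx, rfl⟩ : ∃ x : ℝ, |x| ≤ Real.pi ∧ Circle.exp (c + x) = t := by
    refine ⟨Complex.arg (t * (Circle.exp c)⁻¹ : Circle), Complex.abs_arg_le_pi _, ?_⟩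
    rw [Circle.exp_add, Circle.exp_arg]
    simp
  refine (poisson_discPoint_upper c h0 h1 hx).trans ?_
  have h3 := stepKernel_lower (c := c) n hx
  set W := stepKernel c n (Circle.exp (c + x))
  have hW : 0 ≤ W := stepKernel_nonneg _ _ _
  rw [div_le_iff₀ (by positivity)]
  -- `2⁻ⁿ < 2δ`; squaring the `2` and using the `4` of `stepKernel_lower` gives `2 · 4 · 4 = 32`.
  have h4 : max (|x| / Real.pi) ((1 / 2) ^ n) ≤ 2 * max δ (|x| / Real.pi) := by
    have : 0 ≤ |x| / Real.pi := by positivity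
    refine max_le ?_ ?_
    · linarith [le_max_right δ (|x| / Real.pi)]
    · rw [pow_succ] at hn
      linarith [le_max_left δ (|x| / Real.pi)]
  calc 2 * δ ≤ 2 * (1 / 2) ^ n := by linarith
    _ ≤ 2 * (4 * W * (2 * max δ (|x| / Real.pi)) ^ 2) := by
      refine mul_le_mul_of_nonneg_left (h3.trans ?_) (by norm_num)
      gcongr
    _ = 32 * W * (max δ (|x| / Real.pi)) ^ 2 := by ring

omit [InnerProductSpace ℂ H] [CompleteSpace H] in
-- The coefficient must be below `2`: the recursion for the step kernel halves it, and `1/2 · 3/2 <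
-- 1` makes the induction in `stepKernel_variance_le` contract.
theorem norm_sub_sq_le_of_three_halves (a b c : H) :
    ‖a - c‖ ^ 2 ≤ 3 / 2 * ‖a - b‖ ^ 2 + 3 * ‖b - c‖ ^ 2 := by
  have h : ‖a - c‖ ≤ ‖a - b‖ + ‖b - c‖ := norm_sub_le_norm_sub_add_norm_sub a b c
  have h2 : ‖a - c‖ ^ 2 ≤ (‖a - b‖ + ‖b - c‖) ^ 2 := by gcongr
  nlinarith [sq_nonneg (‖a - b‖ - 2 * ‖b - c‖)]

/-- Write `V n` for the left side. Moving the centre from one dyadic mean to the next costs `3 · 2K`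
times the mass of the kernel, which is at most `2`; hence `V (n+1) ≤ 1/2 (3/2 V n + 12 K) + K = 3/4
V n + 7 K`, whose fixed point is `28 K`. -/
theorem stepKernel_variance_le {u : Circle → H} (hu : MemLp u 2 m) {K : ℝ} (c : ℝ)
    (hK : ∀ n, ∫ t, dyadicDensity c n t *
      ‖u t - ∫ s, dyadicDensity c n s • u s ∂m‖ ^ 2 ∂m ≤ K) (n : ℕ) :
    ∫ t, stepKernel c n t * ‖u t - ∫ s, dyadicDensity c n s • u s ∂m‖ ^ 2 ∂m ≤ 28 * K := by
  have hK0 : 0 ≤ K := (integral_nonneg fun t =>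
    mul_nonneg (arcDensity_nonneg _ _ t) (sq_nonneg _)).trans (hK 0)
  have hmem : ∀ k, MemLp (dyadicDensity c k) ∞ m := fun k => memLp_arcDensity _ _
  induction n with
  | zero => simp only [stepKernel]; linarith [hK 0]
  | succ n ih =>
    set a := ∫ s, dyadicDensity c n s • u s ∂m
    set b := ∫ s, dyadicDensity c (n + 1) s • u s ∂m
    have hW := memLp_stepKernel c n
    -- the means over consecutive dyadic arcs are close
    have hab : ‖a - b‖ ^ 2 ≤ 2 * K := by
      obtain ⟨h1, h2⟩ := dyadic_arc_admissible c (n + 1)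
      have h3 := norm_weighted_mean_sub_sq_le (hmem (n + 1)) (arcDensity_nonneg _ _)
        (integral_arcDensity h1 h2) hu a
      rw [norm_sub_rev]
      refine h3.trans (le_trans ?_ (mul_le_mul_of_nonneg_left (hK n) (by norm_num)))
      rw [← integral_const_mul]
      refine integral_mono (integrable_weight_sq (hmem _) hu _)
        ((integrable_weight_sq (hmem _) hu _).const_mul 2) fun t => ?_
      dsimp only
      rw [← mul_assoc]
      refine mul_le_mul_of_nonneg_right ?_ (sq_nonneg _)
      rw [dyadicDensity, arcDensity]
      refine Set.indicator_apply_le' ?_ fun _ =>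
        mul_nonneg zero_le_two (arcDensity_nonneg _ _ t)
      rintro ⟨θ, hθ, rfl⟩
      have hx : |θ - c| ≤ Real.pi * (1 / 2) ^ (n + 1) := by
        rw [abs_le]; constructor <;> linarith [hθ.1, hθ.2]
      have hx' : |θ - c| ≤ Real.pi * (1 / 2) ^ n := by
        refine hx.trans ?_
        rw [pow_succ]
        have : 0 < Real.pi * (1 / 2) ^ n := by positivity
        linarith
      have e1 := dyadicDensity_apply (c := c) hx
      have e2 := dyadicDensity_apply (c := c) hx'
      rw [add_sub_cancel] at e1 e2
      rw [e2]
      rw [dyadicDensity, arcDensity,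
        Set.indicator_of_mem (show Circle.exp θ ∈ arc _ _ from ⟨θ, hθ, rfl⟩)] at e1
      rw [e1, pow_succ]
      linarith
    have i1 := integrable_weight_sq hW hu a
    have i2 := integrable_weight_sq hW hu b
    have i3 := integrable_weight_sq (hmem (n + 1)) hu b
    have hcomp : ∫ t, stepKernel c n t * ‖u t - b‖ ^ 2 ∂m ≤
        3 / 2 * ∫ t, stepKernel c n t * ‖u t - a‖ ^ 2 ∂m + 12 * K := by
      calc ∫ t, stepKernel c n t * ‖u t - b‖ ^ 2 ∂m
          ≤ ∫ t, (3 / 2 * (stepKernel c n t * ‖u t - a‖ ^ 2) +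
              stepKernel c n t * (3 * ‖a - b‖ ^ 2)) ∂m := by
            refine integral_mono i2 ((i1.const_mul _).add
              ((hW.integrable le_top).mul_const _)) fun t => ?_
            have := mul_le_mul_of_nonneg_left (norm_sub_sq_le_of_three_halves (u t) a b)
              (stepKernel_nonneg c n t)
            dsimp only
            linarith
        _ = 3 / 2 * ∫ t, stepKernel c n t * ‖u t - a‖ ^ 2 ∂m +
              (∫ t, stepKernel c n t ∂m) * (3 * ‖a - b‖ ^ 2) := by
            rw [integral_add (i1.const_mul _) ((hW.integrable le_top).mul_const _),
              integral_const_mul, integral_mul_const]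
        _ ≤ _ := by
            have h2 := integral_stepKernel_le c n
            have : (∫ t, stepKernel c n t ∂m) * (3 * ‖a - b‖ ^ 2) ≤ 2 * (3 * (2 * K)) := by
              gcongr
            linarith
    have hsplit : ∫ t, stepKernel c (n + 1) t * ‖u t - b‖ ^ 2 ∂m =
        1 / 2 * ∫ t, stepKernel c n t * ‖u t - b‖ ^ 2 ∂m +
          ∫ t, dyadicDensity c (n + 1) t * ‖u t - b‖ ^ 2 ∂m := by
      rw [← integral_const_mul, ← integral_add (i2.const_mul _) i3]
      congr 1
      ext t
      simp only [stepKernel]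
      ring
    rw [hsplit]
    have := hK (n + 1)
    linarith

theorem poisson_variance_le_of_arc_variance_le {u : Circle → H} (hu : MemLp u 2 m) {K : ℝ}
    (hK : ∀ α β : ℝ, α < β → β ≤ α + 2 * Real.pi →
      ∫ t, arcDensity α β t * ‖u t - ∫ s, arcDensity α β s • u s ∂m‖ ^ 2 ∂m ≤ K) (z : 𝔻) :
    ∫ t, poisson z t * ‖u t - ∫ s, poisson z s • u s ∂m‖ ^ 2 ∂m ≤ 896 * K := by
  obtain ⟨δ, c, h0, h1, hz⟩ := exists_eq_discPoint z
  obtain ⟨n, hn, hn'⟩ := exists_nat_pow_near_of_lt_one h0 h1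
    (by norm_num : (0 : ℝ) < 1 / 2) (by norm_num)
  -- The Poisson mean may be replaced by the mean over the dyadic arc of size comparable to `1 -
  -- |z|`; the kernel bound `32` and the variance bound `28` multiply to `896`.
  refine (weighted_variance_le (memLp_poisson_real z) (integral_poisson z) hu
    (∫ s, dyadicDensity c n s • u s ∂m)).trans ?_
  have h2 := stepKernel_variance_le hu c (K := K)
    (fun k => hK _ _ (dyadic_arc_admissible c k).1 (dyadic_arc_admissible c k).2) n
  calc _ ≤ ∫ t, 32 * (stepKernel c n t *
        ‖u t - ∫ s, dyadicDensity c n s • u s ∂m‖ ^ 2) ∂m := by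
        refine integral_mono (integrable_weight_sq (memLp_poisson_real z) hu _)
          ((integrable_weight_sq (memLp_stepKernel c n) hu _).const_mul 32) fun t => ?_
        dsimp only
        rw [← mul_assoc]
        refine mul_le_mul_of_nonneg_right ?_ (sq_nonneg _)
        rw [hz]
        exact poisson_le_stepKernel c h0 h1 hn hn' t
    _ ≤ 896 * K := by rw [integral_const_mul]; linarith

end Compare

/-! ### Poisson integrals of vector valued functions -/

theorem norm_one_sub_conj_mul_coe (w : 𝔻) (s : Circle) :
    ‖1 - (starRingEnd ℂ) (w : ℂ) * s‖ = ‖(s : ℂ) - w‖ := by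
  have h : (s : ℂ) - w = s * (starRingEnd ℂ) (1 - (starRingEnd ℂ) (w : ℂ) * s) := by
    have hs : (s : ℂ) * (starRingEnd ℂ) (s : ℂ) = 1 := by
      rw [Complex.mul_conj, Circle.normSq_coe, Complex.ofReal_one]
    simp only [map_sub, map_one, map_mul, Complex.conj_conj]
    linear_combination (w : ℂ) * hs
  rw [h, norm_mul, Circle.norm_coe, one_mul, RCLike.norm_conj]

theorem continuous_poisson_uncurry :
    Continuous fun q : 𝔻 × Circle => poisson q.1 q.2 := by
  unfold poisson
  have h1 : Continuous fun q : 𝔻 × Circle => (q.1 : ℂ) :=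
    Complex.UnitDisc.continuous_coe.comp continuous_fst
  have h2 : Continuous fun q : 𝔻 × Circle => (q.2 : ℂ) :=
    continuous_subtype_val.comp continuous_snd
  refine Continuous.div (by fun_prop) (by fun_prop) fun q => ?_
  have := one_sub_ne_zero_of_norm_lt_one
    (norm_conj_mul_lt_one q.1 (w := q.2) (Circle.norm_coe q.2).le)
  positivity

section

variable {E : Type*} [NormedAddCommGroup E] [NormedSpace ℝ E]

theorem integrable_poisson_smul (z : 𝔻) {g : Circle → E} (hg : Integrable g m) :
    Integrable (fun s => poisson z s • g s) m :=
  Integrable.smul_of_top_right (φ := poisson z) (f := g) hg (memLp_poisson_real z)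

theorem integrable_poisson_smul_prod {p : Circle → 𝔻} (hp : Continuous p) {g : Circle → E}
    (hg : Integrable g m) :
    Integrable (fun q : Circle × Circle => poisson (p q.1) q.2 • g q.2) (m.prod m) := by
  have hc : Continuous fun q : Circle × Circle => poisson (p q.1) q.2 :=
    continuous_poisson_uncurry.comp ((hp.comp continuous_fst).prodMk continuous_snd)
  obtain ⟨C, hC⟩ := isCompact_univ.exists_bound_of_continuousOn hc.continuousOn
  exact Integrable.smul_of_top_right (φ := fun q : Circle × Circle => poisson (p q.1) q.2)
    (f := fun q : Circle × Circle => g q.2) (hg.comp_snd m)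
    (memLp_top_of_bound hc.aestronglyMeasurable C
      (Filter.Eventually.of_forall fun t => hC t (Set.mem_univ t)))

theorem integrable_poissonIntegral_comp {p : Circle → 𝔻} (hp : Continuous p) {g : Circle → E}
    (hg : Integrable g m) : Integrable (fun t => ∫ s, poisson (p t) s • g s ∂m) m :=
  (integrable_poisson_smul_prod hp hg).integral_prod_left

theorem integral_poissonIntegral_comp [CompleteSpace E] {p : Circle → 𝔻} (hp : Continuous p) {z : 𝔻}
    (hmean : ∀ s, ∫ t, poisson (p t) s ∂m = poisson z s) {g : Circle → E}
    (hg : Integrable g m) :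
    ∫ t, ∫ s, poisson (p t) s • g s ∂m ∂m = ∫ s, poisson z s • g s ∂m := by
  rw [integral_integral_swap (integrable_poisson_smul_prod hp hg)]
  simp_rw [integral_smul_const, hmean]

theorem norm_poissonIntegral_le (z : 𝔻) {g : Circle → E} {B : ℝ} (hg : ∀ s, ‖g s‖ ≤ B) :
    ‖∫ s, poisson z s • g s ∂m‖ ≤ B := by
  have h1 : ∫ s, poisson z s * B ∂m = B := by
    rw [integral_mul_const, integral_poisson, one_mul]
  rw [← h1]
  refine norm_integral_le_of_norm_le (((memLp_poisson_real z).integrable le_top).mul_const B)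
    (Eventually.of_forall fun s => ?_)
  rw [norm_smul, Real.norm_eq_abs, abs_of_pos (poisson_pos z s)]
  exact mul_le_mul_of_nonneg_left (hg s) (poisson_pos z s).le

variable [CompleteSpace E]

theorem poissonIntegral_sub_const (z : 𝔻) {g : Circle → E} (hg : Integrable g m) (a : E) :
    ∫ s, poisson z s • (g s - a) ∂m = (∫ s, poisson z s • g s ∂m) - a := by
  simp_rw [smul_sub]
  rw [integral_sub (integrable_poisson_smul z hg)
    (((memLp_poisson_real z).integrable le_top).smul_const a), integral_smul_const,
    integral_poisson, one_smul]

/-- The Poisson integral of a continuous function has the right boundary values. -/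
theorem tendsto_poissonIntegral {ι : Type*} {l : Filter ι} {v : Circle → E} (hv : Continuous v)
    {p : ι → 𝔻} {τ : Circle} (hp : Tendsto (fun i => (p i : ℂ)) l (𝓝 (τ : ℂ))) :
    Tendsto (fun i => ∫ s, poisson (p i) s • v s ∂m) l (𝓝 (v τ)) := by
  have hvi : Integrable v m := hv.integrable_of_hasCompactSupport
    (HasCompactSupport.of_compactSpace _)
  obtain ⟨B, hB⟩ := isCompact_univ.exists_bound_of_continuousOn
    (f := fun s => v s - v τ) (by fun_prop)
  have hB0 : 0 ≤ B := (norm_nonneg _).trans (hB τ (Set.mem_univ τ))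
  rw [Metric.tendsto_nhds]
  intro ε hε
  obtain ⟨η, hη, hvη⟩ := Metric.continuousAt_iff.1 (hv.continuousAt (x := τ)) (ε / 2) (half_pos hε)
  -- The first bound keeps `w` at distance at least `η/2` from points far from `τ`; the second makes
  -- the kernel there at most `ε / (4(B+1))`.
  have hδ : 0 < min (η / 2) (ε * η ^ 2 / (32 * (B + 1))) := by positivity
  filter_upwards [Metric.tendsto_nhds.1 hp _ hδ] with i hi
  set w := p i
  obtain ⟨hi1, hi2⟩ := lt_min_iff.1 hi
  rw [Complex.dist_eq] at hi1 hi2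
  rw [dist_eq_norm, ← poissonIntegral_sub_const w hvi]
  have hw1 : 1 - ‖(w : ℂ)‖ ^ 2 ≤ 2 * ‖(w : ℂ) - τ‖ := by
    have h1 := norm_sub_norm_le (τ : ℂ) w
    rw [Circle.norm_coe, norm_sub_rev] at h1
    nlinarith [norm_nonneg (w : ℂ), w.norm_lt_one]
  have hpt : ∀ s, ‖poisson w s • (v s - v τ)‖ ≤ poisson w s * (ε / 2) + ε / 4 := by
    intro s
    have hpos := poisson_pos w s
    rw [norm_smul, Real.norm_eq_abs, abs_of_pos hpos]
    by_cases hs : dist s τ < η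
    · have h2 := (hvη hs).le
      rw [dist_eq_norm] at h2
      have := mul_le_mul_of_nonneg_left h2 hpos.le
      linarith
    · have h3 : η ≤ ‖(s : ℂ) - τ‖ := by
        rw [← Complex.dist_eq]; exact not_lt.1 hs
      have h4 : η / 2 ≤ ‖(s : ℂ) - w‖ := by
        have := norm_sub_le_norm_sub_add_norm_sub (s : ℂ) w τ
        linarith
      have h5 : poisson w s ≤ 2 * ‖(w : ℂ) - τ‖ / (η / 2) ^ 2 := by
        rw [poisson, norm_one_sub_conj_mul_coe]
        gcongr
      have h6 : poisson w s * (B + 1) ≤ ε / 4 := by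
        calc poisson w s * (B + 1)
            ≤ (2 * (ε * η ^ 2 / (32 * (B + 1))) / (η / 2) ^ 2) * (B + 1) := by
              refine mul_le_mul_of_nonneg_right (h5.trans ?_) (by linarith)
              gcongr
          _ = ε / 4 := by field_simp; norm_num
      have h7 := hB s (Set.mem_univ s)
      have h8 : poisson w s * ‖v s - v τ‖ ≤ poisson w s * (B + 1) :=
        mul_le_mul_of_nonneg_left (by linarith) hpos.le
      have : 0 ≤ poisson w s * (ε / 2) := by positivity
      linarith
  have hPi := (memLp_poisson_real w).integrable le_top
  have hle := norm_integral_le_of_norm_le (μ := m)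
    ((hPi.mul_const (ε / 2)).add (integrable_const (ε / 4))) (Eventually.of_forall hpt)
  have hval : ∫ s, (poisson w s * (ε / 2) + ε / 4) ∂m = ε / 2 + ε / 4 := by
    rw [integral_add (hPi.mul_const _) (integrable_const _), integral_mul_const, integral_poisson]
    simp
  have hle' : ‖∫ s, poisson w s • (v s - v τ) ∂m‖ ≤ ε / 2 + ε / 4 := hle.trans_eq hval
  linarith

end

/-! ### Mean squares of Poisson integrals and their radial limits -/

section

variable {H : Type*} [NormedAddCommGroup H] [InnerProductSpace ℂ H] [CompleteSpace H]

omit [InnerProductSpace ℂ H] [CompleteSpace H] in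
theorem integrable_norm_sub_sq {u : Circle → H} (hu : MemLp u 2 m) (a : H) :
    Integrable (fun t => ‖u t - a‖ ^ 2) m :=
  (hu.sub (memLp_const a)).integrable_norm_pow two_ne_zero

theorem norm_poissonIntegral_sub_sq_le {u : Circle → H} (hu : MemLp u 2 m) (z : 𝔻) (a : H) :
    ‖(∫ s, poisson z s • u s ∂m) - a‖ ^ 2 ≤ ∫ s, poisson z s • ‖u s - a‖ ^ 2 ∂m :=
  norm_weighted_mean_sub_sq_le (memLp_poisson_real z) (fun t => (poisson_pos z t).le)
    (integral_poisson z) hu a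

theorem integrable_norm_poissonIntegral_sub_sq {p : Circle → 𝔻} (hp : Continuous p)
    {u : Circle → H} (hu : MemLp u 2 m) (a : H) :
    Integrable (fun t => ‖(∫ s, poisson (p t) s • u s ∂m) - a‖ ^ 2) m := by
  refine (integrable_poissonIntegral_comp hp (integrable_norm_sub_sq hu a)).mono'
    (((integrable_poissonIntegral_comp hp (hu.integrable one_le_two)).aestronglyMeasurable.sub
      aestronglyMeasurable_const).norm.pow 2) (Eventually.of_forall fun t => ?_)
  rw [Real.norm_of_nonneg (sq_nonneg _)]
  exact norm_poissonIntegral_sub_sq_le hu (p t) a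

/-- Composition with a family of Poisson kernels averaging to `P_z` contracts `L²(P_z m)` into
`L²(m)`. -/
theorem integral_norm_poissonIntegral_sub_sq_le {p : Circle → 𝔻} (hp : Continuous p) {z : 𝔻}
    (hmean : ∀ s, ∫ t, poisson (p t) s ∂m = poisson z s) {u : Circle → H} (hu : MemLp u 2 m)
    (a : H) :
    ∫ t, ‖(∫ s, poisson (p t) s • u s ∂m) - a‖ ^ 2 ∂m ≤ ∫ s, poisson z s * ‖u s - a‖ ^ 2 ∂m := by
  have h := integral_poissonIntegral_comp hp hmean (integrable_norm_sub_sq hu a)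
  simp only [smul_eq_mul] at h
  rw [← h]
  exact integral_mono (integrable_norm_poissonIntegral_sub_sq hp hu a)
    (integrable_poissonIntegral_comp hp (integrable_norm_sub_sq hu a))
    fun t => norm_poissonIntegral_sub_sq_le hu (p t) a

/-- The integrated Poisson integral of `‖v - a‖²` equals the limit for every `n`, by the averaging
hypothesis. It differs from the mean square by the Jensen gap, which is nonnegative, bounded, and
tends to zero pointwise because both of its terms tend to `‖v τ - a‖²`. No change of variables on
the circle is needed. -/
theorem tendsto_integral_norm_poissonIntegral_sub_sq {p : ℕ → Circle → 𝔻}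
    (hp : ∀ n, Continuous (p n)) {z : 𝔻}
    (hmean : ∀ n s, ∫ t, poisson (p n t) s ∂m = poisson z s)
    (hlim : ∀ t, ∃ τ : Circle, Tendsto (fun n => (p n t : ℂ)) atTop (𝓝 (τ : ℂ)))
    {v : Circle → H} (hv : Continuous v) (a : H) :
    Tendsto (fun n => ∫ t, ‖(∫ s, poisson (p n t) s • v s ∂m) - a‖ ^ 2 ∂m) atTop
      (𝓝 (∫ s, poisson z s * ‖v s - a‖ ^ 2 ∂m)) := by
  have hvc : Continuous fun s => ‖v s - a‖ ^ 2 := by fun_prop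
  have hv2 : MemLp v 2 m := by
    obtain ⟨C, hC⟩ := isCompact_univ.exists_bound_of_continuousOn hv.continuousOn
    exact MemLp.of_bound hv.aestronglyMeasurable C
      (Filter.Eventually.of_forall fun t => hC t (Set.mem_univ t))
  obtain ⟨B, hB⟩ := isCompact_univ.exists_bound_of_continuousOn hvc.continuousOn
  have i1 := fun n => integrable_poissonIntegral_comp (hp n) (integrable_norm_sub_sq hv2 a)
  have i2 := fun n => integrable_norm_poissonIntegral_sub_sq (hp n) hv2 a
  have hD : Tendsto (fun n => ∫ t, ((∫ s, poisson (p n t) s • ‖v s - a‖ ^ 2 ∂m) -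
      ‖(∫ s, poisson (p n t) s • v s ∂m) - a‖ ^ 2) ∂m) atTop (𝓝 (∫ _t : Circle, (0 : ℝ) ∂m)) := by
    refine tendsto_integral_of_dominated_convergence (fun _ => B)
      (fun n => ((i1 n).sub (i2 n)).aestronglyMeasurable) (integrable_const B)
      (fun n => Eventually.of_forall fun t => ?_) (Eventually.of_forall fun t => ?_)
    · have h1 := norm_poissonIntegral_sub_sq_le hv2 (p n t) a
      have h2 := norm_poissonIntegral_le (p n t) (B := B) (fun s => hB s (Set.mem_univ s))
      rw [Real.norm_of_nonneg (sub_nonneg.2 h1)]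
      have := (le_abs_self _).trans h2
      linarith [sq_nonneg ‖(∫ s, poisson (p n t) s • v s ∂m) - a‖]
    · obtain ⟨τ, hτ⟩ := hlim t
      have h1 := tendsto_poissonIntegral hvc hτ
      have h2 := (((tendsto_poissonIntegral hv hτ).sub_const a).norm.pow 2)
      simpa using h1.sub h2
  have hE : ∀ n, ∫ t, ‖(∫ s, poisson (p n t) s • v s ∂m) - a‖ ^ 2 ∂m =
      (∫ s, poisson z s * ‖v s - a‖ ^ 2 ∂m) -
      ∫ t, ((∫ s, poisson (p n t) s • ‖v s - a‖ ^ 2 ∂m) -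
      ‖(∫ s, poisson (p n t) s • v s ∂m) - a‖ ^ 2) ∂m := by
    intro n
    rw [integral_sub (i1 n) (i2 n),
      integral_poissonIntegral_comp (hp n) (hmean n) (integrable_norm_sub_sq hv2 a)]
    simp only [smul_eq_mul]
    ring
  simp_rw [hE]
  simpa using hD.const_sub (∫ s, poisson z s * ‖v s - a‖ ^ 2 ∂m)

omit [InnerProductSpace ℂ H] [CompleteSpace H] in
theorem norm_sub_sq_le_two_mul (a b c : H) :
    ‖a - c‖ ^ 2 ≤ 2 * ‖b - c‖ ^ 2 + 2 * ‖a - b‖ ^ 2 := by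
  have h : ‖a - c‖ ≤ ‖a - b‖ + ‖b - c‖ := norm_sub_le_norm_sub_add_norm_sub a b c
  have h2 : ‖a - c‖ ^ 2 ≤ (‖a - b‖ + ‖b - c‖) ^ 2 := by gcongr
  nlinarith [sq_nonneg (‖a - b‖ - ‖b - c‖)]

/-- Pass from `u` to a continuous `L²`-close `v` on the averaged side, let `n → ∞`, and return from
`v` to `u` on the limit side. Each passage uses `(x + y)² ≤ 2x² + 2y²`, whence the factor `4`. -/
theorem poisson_variance_le_of_forall_integral_le {p : ℕ → Circle → 𝔻}
    (hp : ∀ n, Continuous (p n)) {z : 𝔻}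
    (hmean : ∀ n s, ∫ t, poisson (p n t) s ∂m = poisson z s)
    (hlim : ∀ t, ∃ τ : Circle, Tendsto (fun n => (p n t : ℂ)) atTop (𝓝 (τ : ℂ)))
    {u : Circle → H} (hu : MemLp u 2 m) (a : H) {K : ℝ}
    (hK : ∀ n, ∫ t, ‖(∫ s, poisson (p n t) s • u s ∂m) - a‖ ^ 2 ∂m ≤ K) :
    ∫ s, poisson z s * ‖u s - a‖ ^ 2 ∂m ≤ 4 * K := by
  obtain ⟨C, hC⟩ := isCompact_univ.exists_bound_of_continuousOn (continuous_poisson z).continuousOn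
  have hC0 : 0 ≤ C := (norm_nonneg _).trans (hC 1 (Set.mem_univ 1))
  refine le_of_forall_pos_le_add fun ε hε => ?_
  -- With `P_z ≤ C` the weighted error is at most `ε/6`; the two passages turn it into `2 · 2 · ε/6
  -- + 2 · ε/6 = ε`.
  obtain ⟨v, hv, hv2⟩ := MemLp.exists_boundedContinuous_integral_rpow_sub_le (μ := m)
    (p := 2) two_pos (f := u) (by simpa using hu) (ε := ε / (6 * (C + 1))) (by positivity)
  have hv2 : MemLp v 2 m := by simpa using hv2
  have huv : MemLp (fun s => u s - v s) 2 m := hu.sub hv2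
  have i1 := integrable_weight_sq (memLp_poisson_real z) huv (0 : H)
  simp only [sub_zero] at i1
  have he : ∫ s, poisson z s * ‖u s - v s‖ ^ 2 ∂m ≤ ε / 6 := by
    have h1 : ∫ s, ‖u s - v s‖ ^ 2 ∂m ≤ ε / (6 * (C + 1)) := by
      simpa using hv
    calc ∫ s, poisson z s * ‖u s - v s‖ ^ 2 ∂m ≤ ∫ s, (C + 1) * ‖u s - v s‖ ^ 2 ∂m := by
          refine integral_mono i1 (((huv.integrable_norm_pow two_ne_zero)).const_mul _) fun s => ?_
          refine mul_le_mul_of_nonneg_right ?_ (sq_nonneg _)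
          have := (le_abs_self _).trans (hC s (Set.mem_univ s))
          linarith
      _ = (C + 1) * ∫ s, ‖u s - v s‖ ^ 2 ∂m := integral_const_mul _ _
      _ ≤ (C + 1) * (ε / (6 * (C + 1))) := by gcongr
      _ = ε / 6 := by field_simp
  have hvn : ∀ n, ∫ t, ‖(∫ s, poisson (p n t) s • v s ∂m) - a‖ ^ 2 ∂m ≤ 2 * K + 2 * (ε / 6) := by
    intro n
    have j1 := integrable_norm_poissonIntegral_sub_sq (hp n) hu a
    have j2 := integrable_norm_poissonIntegral_sub_sq (hp n) huv 0
    have h2 := integral_norm_poissonIntegral_sub_sq_le (hp n) (hmean n) huv 0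
    simp only [sub_zero] at j2 h2
    calc _ ≤ ∫ t, (2 * ‖(∫ s, poisson (p n t) s • u s ∂m) - a‖ ^ 2 +
          2 * ‖∫ s, poisson (p n t) s • (u s - v s) ∂m‖ ^ 2) ∂m := by
          refine integral_mono (integrable_norm_poissonIntegral_sub_sq (hp n) hv2 a)
            ((j1.const_mul 2).add (j2.const_mul 2)) fun t => ?_
          have h3 : ∫ s, poisson (p n t) s • (u s - v s) ∂m =
              (∫ s, poisson (p n t) s • u s ∂m) - ∫ s, poisson (p n t) s • v s ∂m := by
            simp_rw [smul_sub]
            exact integral_sub (integrable_poisson_smul _ (hu.integrable one_le_two))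
              (integrable_poisson_smul _ (hv2.integrable one_le_two))
          dsimp only
          rw [h3, norm_sub_rev (∫ s, poisson (p n t) s • u s ∂m) (∫ s, poisson (p n t) s • v s ∂m)]
          exact norm_sub_sq_le_two_mul _ _ _
      _ = 2 * ∫ t, ‖(∫ s, poisson (p n t) s • u s ∂m) - a‖ ^ 2 ∂m +
          2 * ∫ t, ‖∫ s, poisson (p n t) s • (u s - v s) ∂m‖ ^ 2 ∂m := by
          rw [integral_add (j1.const_mul 2) (j2.const_mul 2), integral_const_mul,
            integral_const_mul]
      _ ≤ _ := by linarith [hK n]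
  have hvz : ∫ s, poisson z s * ‖v s - a‖ ^ 2 ∂m ≤ 2 * K + 2 * (ε / 6) :=
    le_of_tendsto' (tendsto_integral_norm_poissonIntegral_sub_sq hp hmean hlim v.continuous a) hvn
  have k1 := integrable_weight_sq (memLp_poisson_real z) hv2 a
  calc ∫ s, poisson z s * ‖u s - a‖ ^ 2 ∂m
      ≤ ∫ s, (2 * (poisson z s * ‖v s - a‖ ^ 2) + 2 * (poisson z s * ‖u s - v s‖ ^ 2)) ∂m := by
        refine integral_mono (integrable_weight_sq (memLp_poisson_real z) hu a)
          ((k1.const_mul 2).add (i1.const_mul 2)) fun s => ?_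
        have := mul_le_mul_of_nonneg_left (norm_sub_sq_le_two_mul (u s) (v s) a)
          (poisson_pos z s).le
        dsimp only
        linarith
    _ = 2 * ∫ s, poisson z s * ‖v s - a‖ ^ 2 ∂m + 2 * ∫ s, poisson z s * ‖u s - v s‖ ^ 2 ∂m := by
        rw [integral_add (k1.const_mul 2) (i1.const_mul 2), integral_const_mul, integral_const_mul]
    _ ≤ 4 * K + ε := by linarith

end

/-! ### Möbius transformations -/

theorem exists_extension_of_mem_mobius {ψ : 𝔻 → 𝔻} (h : ψ ∈ mobius) :
    ∃ Ψ : ℂ → ℂ, (∀ w, ‖w‖ ≤ 1 → DifferentiableAt ℂ Ψ w) ∧ (∀ w, ‖w‖ = 1 → ‖Ψ w‖ = 1) ∧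
      ∀ z : 𝔻, (ψ z : ℂ) = Ψ z := by
  obtain ⟨θ, z₀, hψ⟩ := h
  have hne : ∀ w : ℂ, ‖w‖ ≤ 1 → 1 - (starRingEnd ℂ) (z₀ : ℂ) * w ≠ 0 := fun w hw =>
    one_sub_ne_zero_of_norm_lt_one (norm_conj_mul_lt_one z₀ hw)
  refine ⟨fun w =>
      Complex.exp (Complex.I * θ) * ((w - z₀ : ℂ) / (1 - (starRingEnd ℂ) (z₀ : ℂ) * w)),
    fun w hw => ?_, fun w hw => ?_, hψ⟩
  · have h1 : DifferentiableAt ℂ (fun w : ℂ => (w - z₀) / (1 - (starRingEnd ℂ) (z₀ : ℂ) * w)) w :=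
      DifferentiableAt.div (by fun_prop) (by fun_prop) (hne w hw)
    exact h1.const_mul _
  · have h1 : ‖1 - (starRingEnd ℂ) (z₀ : ℂ) * w‖ = ‖w - z₀‖ :=
      norm_one_sub_conj_mul_coe z₀ ⟨w, mem_sphere_zero_iff_norm.2 hw⟩
    have h2 : ‖1 - (starRingEnd ℂ) (z₀ : ℂ) * w‖ ≠ 0 := norm_ne_zero_iff.2 (hne w hw.le)
    rw [norm_mul, norm_div, ← h1, div_self h2, mul_comm Complex.I, Complex.norm_exp_ofReal_mul_I,
      one_mul]

theorem exists_mem_mobius_apply_zero (z : 𝔻) : ∃ ψ ∈ mobius, ψ 0 = z := by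
  have hne : ∀ w : 𝔻, 1 + (starRingEnd ℂ) (z : ℂ) * w ≠ 0 := fun w => by
    have := one_sub_ne_zero_of_norm_lt_one (norm_conj_mul_lt_one (-z) w.norm_lt_one.le)
    simpa using this
  have hlt : ∀ w : 𝔻, ‖((w + z : ℂ) / (1 + (starRingEnd ℂ) (z : ℂ) * w))‖ < 1 := fun w => by
    rw [norm_div, div_lt_one (norm_pos_iff.2 (hne w)), ← sq_lt_sq₀ (norm_nonneg _) (norm_nonneg _),
      Complex.sq_norm, Complex.sq_norm]
    have h1 := z.normSq_lt_one
    have h2 := w.normSq_lt_one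
    rw [Complex.normSq_apply] at h1 h2
    have h3 := mul_pos (sub_pos.2 h1) (sub_pos.2 h2)
    simp only [Complex.normSq_apply, Complex.add_re, Complex.add_im, Complex.one_re,
      Complex.one_im, Complex.mul_re, Complex.mul_im, Complex.conj_re, Complex.conj_im]
    nlinarith
  -- `w ↦ (w + z) / (1 + z̄ w)`; `hlt` rests on `|1 + z̄w|² - |w + z|² = (1 - |z|²)(1 - |w|²)`.
  refine ⟨fun w => Complex.UnitDisc.mk _ (hlt w), ⟨0, -z, fun w => ?_⟩, ?_⟩
  · simp
  · apply Complex.UnitDisc.coe_injective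
    simp

/-- The point `γ t` of the disc. -/
noncomputable def radial (γ : Set.Ioo (0 : ℝ) 1) (t : Circle) : 𝔻 :=
  Complex.UnitDisc.mk ((γ : ℝ) * (t : ℂ))
    (by simpa [abs_of_pos γ.2.1, Circle.norm_coe] using γ.2.2)

theorem continuous_radial (γ : Set.Ioo (0 : ℝ) 1) : Continuous (radial γ) := by
  refine Complex.UnitDisc.isEmbedding_coe.continuous_iff.2 ?_
  change Continuous fun t : Circle => ((γ : ℝ) : ℂ) * (t : ℂ)
  fun_prop

theorem continuous_of_mem_mobius {ψ : 𝔻 → 𝔻} (h : ψ ∈ mobius) : Continuous ψ := by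
  obtain ⟨Ψ, hd, -, hψ⟩ := exists_extension_of_mem_mobius h
  refine Complex.UnitDisc.isEmbedding_coe.continuous_iff.2
    (continuous_iff_continuousAt.2 fun z => ?_)
  have : (fun z : 𝔻 => (z : ℂ)) ∘ ψ = Ψ ∘ fun z : 𝔻 => (z : ℂ) := funext hψ
  change ContinuousAt ((fun z : 𝔻 => (z : ℂ)) ∘ ψ) z
  rw [this]
  exact ContinuousAt.comp (f := fun z : 𝔻 => (z : ℂ)) (hd z z.norm_lt_one.le).continuousAt
    Complex.UnitDisc.continuous_coe.continuousAt

theorem integral_poisson_mobius_radial {ψ : 𝔻 → 𝔻} (h : ψ ∈ mobius) (γ : Set.Ioo (0 : ℝ) 1)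
    (s : Circle) : ∫ t, poisson (ψ (radial γ t)) s ∂m = poisson (ψ 0) s := by
  obtain ⟨Ψ, hd, -, hψ⟩ := exists_extension_of_mem_mobius h
  have hγ : ∀ w : ℂ, ‖w‖ ≤ 1 → ‖((γ : ℝ) : ℂ) * w‖ < 1 := fun w hw => by
    rw [norm_mul, Complex.norm_real, Real.norm_of_nonneg γ.2.1.le]
    exact mul_lt_one_of_nonneg_of_lt_one_left γ.2.1.le γ.2.2 hw
  refine integral_poisson_comp (ψ := fun w => Ψ (((γ : ℝ) : ℂ) * w)) (fun w hw => ?_)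
    (fun w hw => ?_) (fun t => hψ _) ?_ s
  · exact DifferentiableAt.comp w (hd _ (hγ w hw).le) (by fun_prop)
  · have := (ψ (Complex.UnitDisc.mk _ (hγ w hw))).norm_lt_one
    rwa [hψ] at this
  · rw [hψ]; simp

theorem tendsto_mobius_radial {ψ : 𝔻 → 𝔻} (h : ψ ∈ mobius) {γ : ℕ → Set.Ioo (0 : ℝ) 1}
    (hγ : Tendsto (fun n => (γ n : ℝ)) atTop (𝓝 1)) (t : Circle) :
    ∃ τ : Circle, Tendsto (fun n => (ψ (radial (γ n) t) : ℂ)) atTop (𝓝 (τ : ℂ)) := by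
  obtain ⟨Ψ, hd, h1, hψ⟩ := exists_extension_of_mem_mobius h
  refine ⟨⟨Ψ t, mem_sphere_zero_iff_norm.2 (h1 t (Circle.norm_coe t))⟩, ?_⟩
  simp_rw [hψ]
  refine ((hd t (Circle.norm_coe t).le).continuousAt.tendsto).comp ?_
  have h2 : Tendsto (fun n => (((γ n : ℝ) : ℂ) * (t : ℂ))) atTop (𝓝 (((1 : ℝ) : ℂ) * (t : ℂ))) :=
    ((Complex.continuous_ofReal.tendsto 1).comp hγ).mul_const _
  rwa [Complex.ofReal_one, one_mul] at h2

theorem exists_seq_Ioo_tendsto_one :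
    ∃ γ : ℕ → Set.Ioo (0 : ℝ) 1, Tendsto (fun n => (γ n : ℝ)) atTop (𝓝 1) := by
  obtain ⟨γ, -, h1, h2⟩ := exists_seq_strictMono_tendsto' (zero_lt_one : (0 : ℝ) < 1)
  exact ⟨fun n => ⟨γ n, h1 n⟩, h2⟩

/-! ### Operator valued analytic functions -/

section Analytic

variable {H : Type u} [NormedAddCommGroup H] [InnerProductSpace ℂ H] [CompleteSpace H]

/-- The underlying linear subspace of a von Neumann algebra. -/
def vnSubmodule (M : VonNeumannAlgebra H) : Submodule ℂ (H →L[ℂ] H) :=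
  Subalgebra.toSubmodule M.toStarSubalgebra.toSubalgebra

/-- A bicommutant is norm closed. Hence `M` is a Banach space, and Taylor coefficients of `M`-valued
holomorphic functions lie in `M` automatically. -/
theorem isClosed_vnSubmodule (M : VonNeumannAlgebra H) :
    IsClosed (vnSubmodule M : Set (H →L[ℂ] H)) := by
  have h : (vnSubmodule M : Set (H →L[ℂ] H)) =
      Set.centralizer (Set.centralizer (M : Set (H →L[ℂ] H))) :=
    M.centralizer_centralizer.symm
  rw [h]
  exact Set.isClosed_centralizer _

instance instCompleteSpaceVnSubmodule (M : VonNeumannAlgebra H) : CompleteSpace (vnSubmodule M) :=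
  (isClosed_vnSubmodule M).completeSpace_coe

theorem mem_analyticOn_of_differentiableOn {M : VonNeumannAlgebra H} {G : ℂ → vnSubmodule M}
    (hG : DifferentiableOn ℂ G (Metric.ball 0 1)) :
    (fun z : 𝔻 => (G (z : ℂ) : H →L[ℂ] H)) ∈ analyticOn M := by
  refine ⟨fun n => (((n.factorial : ℂ)⁻¹ • iteratedDeriv n G 0 : vnSubmodule M) : H →L[ℂ] H),
    fun n => Subtype.property _, fun z => ?_⟩
  have h := Complex.hasSum_taylorSeries_on_ball hG
    (show (z : ℂ) ∈ Metric.ball (0 : ℂ) 1 by simpa using z.norm_lt_one)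
  have h2 := (vnSubmodule M).subtypeL.hasSum h
  have h3 : (fun n => (z : ℂ) ^ n • (((n.factorial : ℂ)⁻¹ • iteratedDeriv n G 0 : vnSubmodule M) :
      H →L[ℂ] H)) = fun n => (vnSubmodule M).subtypeL
        ((n.factorial : ℂ)⁻¹ • ((z : ℂ) - 0) ^ n • iteratedDeriv n G 0) := by
    ext1 n
    rw [sub_zero, smul_comm]
    rfl
  rw [h3]
  exact h2

theorem exists_differentiableOn_of_mem_analyticOn {M : VonNeumannAlgebra H}
    {F : 𝔻 → (H →L[ℂ] H)} (hF : F ∈ analyticOn M) :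
    ∃ G : ℂ → vnSubmodule M, DifferentiableOn ℂ G (Metric.ball 0 1) ∧
      ∀ z : 𝔻, (G z : H →L[ℂ] H) = F z := by
  obtain ⟨a, ha, hs⟩ := hF
  let b : ℕ → vnSubmodule M := fun n => ⟨a n, ha n⟩
  -- Convergence at a larger radius `ρ` bounds the terms there, and comparison with a geometric
  -- series gives absolute convergence at `r`.
  have hbound : ∀ r : ℝ, 0 < r → r < 1 → Summable fun n => r ^ n * ‖a n‖ := by
    intro r hr0 hr1
    obtain ⟨ρ, hρ0, hρ1⟩ := exists_between hr1
    have hρpos : 0 < ρ := hr0.trans hρ0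
    have h1 := (hs (Complex.UnitDisc.mk (ρ : ℂ) (by
      rwa [Complex.norm_real, Real.norm_of_nonneg hρpos.le]))).summable.tendsto_atTop_zero
    obtain ⟨C, hC⟩ := h1.norm.bddAbove_range
    refine Summable.of_nonneg_of_le (fun n => by positivity) (fun n => ?_)
      ((summable_geometric_of_lt_one (by positivity : 0 ≤ r / ρ)
        ((div_lt_one hρpos).2 hρ0)).mul_left C)
    have h2 : ρ ^ n * ‖a n‖ ≤ C := by
      have := hC ⟨n, rfl⟩
      simpa [norm_smul, abs_of_pos hρpos] using this
    calc r ^ n * ‖a n‖ = (ρ ^ n * ‖a n‖) * (r / ρ) ^ n := by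
          rw [div_pow]; field_simp
      _ ≤ C * (r / ρ) ^ n := by gcongr
  refine ⟨fun w => ∑' n, w ^ n • b n, fun w hw => ?_, fun z => ?_⟩
  · obtain ⟨r, hr0, hr1⟩ := exists_between (show ‖w‖ < 1 by simpa using hw)
    have hd := Complex.differentiableOn_tsum_of_summable_norm
      (F := fun n w => w ^ n • b n) (U := Metric.ball (0 : ℂ) r)
      (hbound r ((norm_nonneg w).trans_lt hr0) hr1)
      (fun n => by fun_prop) Metric.isOpen_ball (fun n x hx => by
        have hx' : ‖x‖ ≤ r := by simpa using (Metric.mem_ball.1 hx).le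
        rw [norm_smul, norm_pow]
        change ‖x‖ ^ n * ‖a n‖ ≤ _
        gcongr)
    exact (hd.differentiableAt
      (Metric.isOpen_ball.mem_nhds (by simpa using hr0))).differentiableWithinAt
  · have hsum : Summable fun n => (z : ℂ) ^ n • b n := by
      obtain ⟨r, hr0, hr1⟩ := exists_between z.norm_lt_one
      refine Summable.of_norm_bounded (hbound r ((norm_nonneg _).trans_lt hr0) hr1) fun n => ?_
      rw [norm_smul, norm_pow]
      change ‖(z : ℂ)‖ ^ n * ‖a n‖ ≤ _
      gcongr
    exact ((vnSubmodule M).subtypeL.hasSum hsum.hasSum).unique (hs z)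

/-- This makes the membership condition in `translates` automatic, so the supremum runs over all
Möbius maps. -/
theorem comp_mobius_mem_analyticOn {M : VonNeumannAlgebra H} {F : 𝔻 → (H →L[ℂ] H)}
    (hF : F ∈ analyticOn M) {ψ : 𝔻 → 𝔻} (hψ : ψ ∈ mobius) :
    (fun z => F (ψ z) - F (ψ 0)) ∈ analyticOn M := by
  obtain ⟨G, hG, hGF⟩ := exists_differentiableOn_of_mem_analyticOn hF
  obtain ⟨Ψ, hd, -, hΨ⟩ := exists_extension_of_mem_mobius hψ
  have hmaps : Set.MapsTo Ψ (Metric.ball 0 1) (Metric.ball 0 1) := fun w hw => by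
    have hw' : ‖w‖ < 1 := by simpa using hw
    have := (ψ (Complex.UnitDisc.mk w hw')).norm_lt_one
    rw [hΨ] at this
    simpa using this
  have hdiff : DifferentiableOn ℂ (fun w => G (Ψ w) - G (ψ 0)) (Metric.ball 0 1) :=
    (hG.comp (fun w hw => (hd w (by simpa using (Metric.mem_ball.1 hw).le)).differentiableWithinAt)
      hmaps).sub_const _
  have h := mem_analyticOn_of_differentiableOn hdiff
  convert h using 2 with z
  rw [Submodule.coe_sub, ← hΨ, hGF, hGF]

theorem continuous_of_mem_analyticOn {M : VonNeumannAlgebra H} {F : 𝔻 → (H →L[ℂ] H)}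
    (hF : F ∈ analyticOn M) : Continuous F := by
  obtain ⟨G, hG, hGF⟩ := exists_differentiableOn_of_mem_analyticOn hF
  have h1 : Continuous fun z : 𝔻 => G z :=
    hG.continuousOn.comp_continuous Complex.UnitDisc.continuous_coe
      fun z => by simpa using z.norm_lt_one
  have h2 : F = fun z : 𝔻 => (G z : H →L[ℂ] H) := funext fun z => (hGF z).symm
  rw [h2]
  exact continuous_subtype_val.comp h1

end Analytic

section Operators

variable {H : Type u} [NormedAddCommGroup H] [InnerProductSpace ℂ H] [CompleteSpace H]

/-! ### Quadratic forms of the operators in the definitions of the norms -/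

theorem enorm_sqrt_le_iff {A : H →L[ℂ] H} {q : H → ℝ} (hA : ∀ h, ⟪h, A h⟫_ℂ = (q h : ℂ))
    (hq : ∀ h, 0 ≤ q h) (B : ℝ≥0) :
    ‖CFC.sqrt A‖ₑ ≤ B ↔ ∀ h, q h ≤ B ^ 2 * ‖h‖ ^ 2 := by
  have hA' : ∀ h, ⟪A h, h⟫_ℂ = (q h : ℂ) := fun h => by
    rw [← inner_conj_symm, hA, Complex.conj_ofReal]
  have hpos : 0 ≤ A := by
    rw [ContinuousLinearMap.nonneg_iff_isPositive, ContinuousLinearMap.isPositive_iff_complex]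
    intro h
    rw [hA']
    simpa using hq h
  set T := CFC.sqrt A with hT
  have hTT : T * T = A := CFC.sqrt_mul_sqrt_self A hpos
  have hTs : IsSelfAdjoint T := IsSelfAdjoint.of_nonneg (CFC.sqrt_nonneg A)
  have hnorm : ∀ h, ‖T h‖ ^ 2 = q h := by
    intro h
    have h1 : ⟪T h, T h⟫_ℂ = (q h : ℂ) := by
      rw [← ContinuousLinearMap.adjoint_inner_right, ← ContinuousLinearMap.star_eq_adjoint,
        hTs.star_eq, ← hA, ← hTT]
      rfl
    rw [inner_self_eq_norm_sq_to_K] at h1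
    have h2 : ((‖T h‖ ^ 2 : ℝ) : ℂ) = (q h : ℂ) := by
      push_cast
      exact h1
    exact Complex.ofReal_injective h2
  have hle : ‖T‖ₑ ≤ B ↔ ‖T‖ ≤ B := by
    rw [enorm_eq_nnnorm, ENNReal.coe_le_coe, ← NNReal.coe_le_coe, coe_nnnorm]
  rw [hle]
  refine (ContinuousLinearMap.opNorm_le_iff B.2).trans (forall_congr' fun h => ?_)
  rw [← hnorm, ← mul_pow, sq_le_sq₀ (norm_nonneg _) (by positivity)]
  rfl

omit [CompleteSpace H] in
theorem coeFn_mulL (w : Lp ℂ ∞ m) (v : Lp H 2 m) : mulL w v =ᵐ[m] fun t => w t • v t :=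
  ContinuousLinearMap.coeFn_holder (r := 2)
    (ContinuousLinearMap.lsmul ℂ ℂ : ℂ →L[ℂ] H →L[ℂ] H) w v

theorem wIntegral_apply {w : Lp ℂ ∞ m} {ρ : Circle → ℝ} (hw : ∀ᵐ t ∂m, w t = (ρ t : ℂ))
    (f : Col H) (h : H) : wIntegral w f h = ∫ t, ρ t • f h t ∂m := by
  rw [wIntegral]
  change integralL (mulL w (f h)) = _
  rw [integralL_apply]
  refine integral_congr_ae ?_
  filter_upwards [hw, coeFn_mulL w (f h)] with t h1 h2
  rw [h2, h1, Complex.coe_smul]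

theorem inner_wSquare {w : Lp ℂ ∞ m} {ρ : Circle → ℝ} (hw : ∀ᵐ t ∂m, w t = (ρ t : ℂ))
    (f : Col H) (h : H) :
    ⟪h, wSquare w f h⟫_ℂ = ((∫ t, ρ t * ‖f h t‖ ^ 2 ∂m : ℝ) : ℂ) := by
  rw [wSquare]
  change ⟪h, f.adjoint (mulL w (f h))⟫_ℂ = _
  rw [ContinuousLinearMap.adjoint_inner_right, L2.inner_def, ← integral_complex_ofReal]
  refine integral_congr_ae ?_
  filter_upwards [hw, coeFn_mulL w (f h)] with t h1 h2
  rw [h2, h1, inner_smul_right, inner_self_eq_norm_sq_to_K]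
  push_cast
  rfl

theorem coeFn_sub_constCol (f : Col H) (a : H →L[ℂ] H) (h : H) :
    (f - constCol a) h =ᵐ[m] fun t => f h t - a h := by
  have h1 : (f - constCol a) h = f h - Lp.const 2 m (a h) := rfl
  rw [h1]
  filter_upwards [Lp.coeFn_sub (f h) (Lp.const 2 m (a h)), Lp.coeFn_const 2 m (a h)] with t h2 h3
  rw [h2, Pi.sub_apply, h3]
  rfl

/-- The common form of the arc and Garsia norms: the weight `ρ` is either a normalized arc density
or a Poisson kernel. -/
theorem enorm_sqrt_wSquare_le_iff {w : Lp ℂ ∞ m} {ρ : Circle → ℝ}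
    (hw : ∀ᵐ t ∂m, w t = (ρ t : ℂ)) (hρ : ∀ t, 0 ≤ ρ t) (f : Col H) (B : ℝ≥0) :
    ‖CFC.sqrt (wSquare w (f - constCol (wIntegral w f)))‖ₑ ≤ B ↔
      ∀ h, ∫ t, ρ t * ‖f h t - ∫ s, ρ s • f h s ∂m‖ ^ 2 ∂m ≤ B ^ 2 * ‖h‖ ^ 2 := by
  refine enorm_sqrt_le_iff (fun h => ?_) (fun h => integral_nonneg fun t =>
    mul_nonneg (hρ t) (sq_nonneg _)) B
  rw [inner_wSquare hw]
  congr 1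
  refine integral_congr_ae ?_
  filter_upwards [coeFn_sub_constCol f (wIntegral w f) h] with t ht
  rw [ht, wIntegral_apply hw]

theorem poissonWeight_ae (z : 𝔻) : ∀ᵐ t ∂m, poissonWeight z t = (poisson z t : ℂ) :=
  (memLp_poisson z).coeFn_toLp

theorem arcWeight_ae (α β : ℝ) :
    ∀ᵐ t ∂m, ((((m.real (arc α β))⁻¹ : ℝ) : ℂ) • arcWeight α β) t = (arcDensity α β t : ℂ) := by
  filter_upwards [Lp.coeFn_smul (((m.real (arc α β))⁻¹ : ℝ) : ℂ) (arcWeight α β),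
    indicatorConstLp_coeFn (p := ∞) (hs := measurableSet_arc α β)
      (hμs := measure_ne_top m (arc α β)) (c := (1 : ℂ))] with t h1 h2
  rw [h1, Pi.smul_apply, arcWeight, h2, arcDensity]
  by_cases ht : t ∈ arc α β <;> simp [ht]

omit [CompleteSpace H] in
theorem mulL_smul (c : ℂ) (w : Lp ℂ ∞ m) :
    (mulL (c • w) : Lp H 2 m →L[ℂ] Lp H 2 m) = c • mulL w := by
  rw [mulL, map_smul]
  rfl

theorem smul_wIntegral (c : ℂ) (w : Lp ℂ ∞ m) (f : Col H) :
    c • wIntegral w f = wIntegral (c • w) f := by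
  rw [wIntegral, wIntegral, mulL_smul, ContinuousLinearMap.smul_comp,
    ContinuousLinearMap.comp_smul]

theorem smul_wSquare (c : ℂ) (w : Lp ℂ ∞ m) (f : Col H) :
    c • wSquare w f = wSquare (c • w) f := by
  rw [wSquare, wSquare, mulL_smul, ContinuousLinearMap.smul_comp, ContinuousLinearMap.comp_smul]

theorem garsiaNorm_le_iff (f : Col H) (B : ℝ≥0) :
    garsiaNorm f ≤ B ↔ ∀ (z : 𝔻) (h : H),
      ∫ t, poisson z t * ‖f h t - ∫ s, poisson z s • f h s ∂m‖ ^ 2 ∂m ≤ B ^ 2 * ‖h‖ ^ 2 := by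
  rw [garsiaNorm, iSup_le_iff]
  exact forall_congr' fun z => enorm_sqrt_wSquare_le_iff (poissonWeight_ae z)
    (fun t => (poisson_pos z t).le) f B

theorem starNorm_le_iff (f : Col H) (B : ℝ≥0) :
    starNorm f ≤ B ↔ ∀ α β : ℝ, α < β → β ≤ α + 2 * Real.pi → ∀ h : H,
      ∫ t, arcDensity α β t * ‖f h t - ∫ s, arcDensity α β s • f h s ∂m‖ ^ 2 ∂m ≤
        B ^ 2 * ‖h‖ ^ 2 := by
  simp only [starNorm, iSup_le_iff, and_imp]
  refine forall_congr' fun α => forall_congr' fun β => imp_congr_right fun _ =>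
    imp_congr_right fun _ => ?_
  rw [smul_wSquare, arcMean, smul_wIntegral]
  exact enorm_sqrt_wSquare_le_iff (arcWeight_ae α β) (arcDensity_nonneg α β) f B

theorem linftyColNorm_le_iff {φ : Circle → (H →L[ℂ] H)} (hφ : Continuous φ) (B : ℝ≥0) :
    linftyColNorm φ ≤ B ↔ ∀ h, ∫ t, ‖φ t h‖ ^ 2 ∂m ≤ B ^ 2 * ‖h‖ ^ 2 := by
  have hc : Continuous fun t => star (φ t) * φ t := (continuous_star.comp hφ).mul hφ
  have hi : Integrable (fun t => star (φ t) * φ t) m := hc.integrable_of_hasCompactSupport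
    (HasCompactSupport.of_compactSpace _)
  refine enorm_sqrt_le_iff (fun h => ?_) (fun h => integral_nonneg fun t => sq_nonneg _) B
  rw [ContinuousLinearMap.integral_apply hi, ← integral_inner (hi.apply_continuousLinearMap h),
    ← integral_complex_ofReal]
  congr 1
  ext t
  rw [ContinuousLinearMap.star_eq_adjoint, mul_apply_eq_comp,
    ContinuousLinearMap.adjoint_inner_right, inner_self_eq_norm_sq_to_K]
  push_cast
  rfl

theorem poissonInt_apply (f : Col H) (z : 𝔻) (h : H) :
    poissonInt f z h = ∫ s, poisson z s • f h s ∂m :=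
  wIntegral_apply (poissonWeight_ae z) f h

theorem translateNorm_le_iff {M : VonNeumannAlgebra H} {f : Col H}
    (hf : poissonInt f ∈ analyticOn M) (B : ℝ≥0) :
    translateNorm M f ≤ B ↔ ∀ ψ ∈ mobius, ∀ (γ : Set.Ioo (0 : ℝ) 1) (h : H),
      ∫ t, ‖(∫ s, poisson (ψ (radial γ t)) s • f h s ∂m) - ∫ s, poisson (ψ 0) s • f h s ∂m‖ ^ 2 ∂m
        ≤ B ^ 2 * ‖h‖ ^ 2 := by
  have key : ∀ ψ ∈ mobius, ∀ γ : Set.Ioo (0 : ℝ) 1,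
      linftyColNorm (dilate (fun z => poissonInt f (ψ z) - poissonInt f (ψ 0)) γ) ≤ B ↔ ∀ h : H,
      ∫ t, ‖(∫ s, poisson (ψ (radial γ t)) s • f h s ∂m) -
        ∫ s, poisson (ψ 0) s • f h s ∂m‖ ^ 2 ∂m ≤ B ^ 2 * ‖h‖ ^ 2 := by
    intro ψ hψ γ
    have hc : Continuous (dilate (fun z => poissonInt f (ψ z) - poissonInt f (ψ 0)) γ) :=
      (continuous_of_mem_analyticOn (comp_mobius_mem_analyticOn hf hψ)).comp (continuous_radial γ)
    rw [linftyColNorm_le_iff hc]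
    simp only [← poissonInt_apply]
    rfl
  simp only [translateNorm, iSup_le_iff]
  constructor
  · intro H1 ψ hψ γ
    exact (key ψ hψ γ).1 (H1 _ ⟨comp_mobius_mem_analyticOn hf hψ, ψ, hψ, rfl⟩ γ)
  · rintro H1 g ⟨-, ψ, hψ, rfl⟩ γ
    exact (key ψ hψ γ).2 (H1 ψ hψ γ)

/-! ### Comparison of the norms -/

theorem translateNorm_le_garsiaNorm {M : VonNeumannAlgebra H} {f : Col H}
    (hf : poissonInt f ∈ analyticOn M) {B : ℝ≥0} (h : garsiaNorm f ≤ B) :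
    translateNorm M f ≤ B := by
  rw [garsiaNorm_le_iff] at h
  rw [translateNorm_le_iff hf]
  intro ψ hψ γ x
  exact (integral_norm_poissonIntegral_sub_sq_le
    ((continuous_of_mem_mobius hψ).comp (continuous_radial γ))
    (integral_poisson_mobius_radial hψ γ) (Lp.memLp (f x)) _).trans (h (ψ 0) x)

theorem garsiaNorm_le_translateNorm {M : VonNeumannAlgebra H} {f : Col H}
    (hf : poissonInt f ∈ analyticOn M) {B : ℝ≥0} (h : translateNorm M f ≤ B) :
    garsiaNorm f ≤ (2 * B : ℝ≥0) := by
  rw [translateNorm_le_iff hf] at h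
  rw [garsiaNorm_le_iff]
  intro z x
  obtain ⟨ψ, hψ, rfl⟩ := exists_mem_mobius_apply_zero z
  obtain ⟨γ, hγ⟩ := exists_seq_Ioo_tendsto_one
  refine (poisson_variance_le_of_forall_integral_le
    (p := fun n t => ψ (radial (γ n) t))
    (fun n => (continuous_of_mem_mobius hψ).comp (continuous_radial (γ n)))
    (fun n => integral_poisson_mobius_radial hψ (γ n)) (tendsto_mobius_radial hψ hγ)
    (Lp.memLp (f x)) _ (fun n => h ψ hψ (γ n) x)).trans_eq ?_
  push_cast
  ring

theorem starNorm_le_garsiaNorm {f : Col H} {B : ℝ≥0} (h : garsiaNorm f ≤ B) :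
    starNorm f ≤ (6 * B : ℝ≥0) := by
  rw [garsiaNorm_le_iff] at h
  rw [starNorm_le_iff]
  intro α β h1 h2 x
  refine (arc_variance_le_of_poisson_variance_le (Lp.memLp (f x)) (fun z => h z x) h1 h2).trans ?_
  push_cast
  have : 0 ≤ (B : ℝ) ^ 2 * ‖x‖ ^ 2 := by positivity
  nlinarith

theorem garsiaNorm_le_starNorm {f : Col H} {B : ℝ≥0} (h : starNorm f ≤ B) :
    garsiaNorm f ≤ (32 * B : ℝ≥0) := by
  rw [starNorm_le_iff] at h
  rw [garsiaNorm_le_iff]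
  intro z x
  refine (poisson_variance_le_of_arc_variance_le (Lp.memLp (f x))
    (fun α β h1 h2 => h α β h1 h2 x) z).trans ?_
  push_cast
  have : 0 ≤ (B : ℝ) ^ 2 * ‖x‖ ^ 2 := by positivity
  nlinarith

end Operators

/-! ### From finite bounds to two-sided estimates in `ℝ≥0∞` -/

theorem le_mul_of_forall_le {X Y : ℝ≥0∞} {C : ℝ≥0} (hC : C ≠ 0)
    (h : ∀ B : ℝ≥0, Y ≤ B → X ≤ (C * B : ℝ≥0)) : X ≤ C * Y := by
  rcases eq_or_ne Y ∞ with rfl | hY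
  -- `C ≠ 0` matters here, since `0 * ∞ = 0`.
  · rw [ENNReal.mul_top (by simpa using hC)]
    exact le_top
  · lift Y to ℝ≥0 using hY
    simpa using h Y le_rfl

theorem asympWith_of_forall_le {X Y : ℝ≥0∞} {C : ℝ≥0} (hC : C ≠ 0)
    (h1 : ∀ B : ℝ≥0, Y ≤ B → X ≤ (C * B : ℝ≥0)) (h2 : ∀ B : ℝ≥0, X ≤ B → Y ≤ (C * B : ℝ≥0)) :
    AsympWith C X Y := by
  refine ⟨?_, le_mul_of_forall_le hC h2⟩
  rw [mul_comm, ← div_eq_mul_inv]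
  refine ENNReal.div_le_of_le_mul ?_
  rw [mul_comm]
  exact le_mul_of_forall_le hC h1

theorem coe_mul_le_coe_mul {C D : ℝ≥0} (h : C ≤ D) (B : ℝ≥0) :
    ((C * B : ℝ≥0) : ℝ≥0∞) ≤ (D * B : ℝ≥0) :=
  ENNReal.coe_le_coe.2 (mul_le_mul_left h B)

end OpBMO

theorem proposition4p2 :
    ∃ C : ℝ≥0, 0 < C ∧
      ∀ (H : Type u) [NormedAddCommGroup H] [InnerProductSpace ℂ H] [CompleteSpace H]
        (M : VonNeumannAlgebra H) (τ : OpBMO.NSFTrace M) (f : OpBMO.Col H),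
        f ∈ OpBMO.BMOAc τ →
          OpBMO.AsympWith C (OpBMO.starNorm f) (OpBMO.translateNorm M f) ∧
          OpBMO.AsympWith C (OpBMO.translateNorm M f) (OpBMO.garsiaNorm f) := by
  -- The largest constant used: `32² ≥ 896` for Garsia by arcs, while `6 · 2` and `2` suffice for
  -- arcs by translates and Garsia by translates.
  refine ⟨32, by norm_num, fun H _ _ _ M τ f hf => ?_⟩
  have hF := hf.2.2
  have h32 : (32 : ℝ≥0) ≠ 0 := by norm_num
  refine ⟨OpBMO.asympWith_of_forall_le h32 (fun B hB => ?_) (fun B hB => ?_),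
    OpBMO.asympWith_of_forall_le h32 (fun B hB => ?_) (fun B hB => ?_)⟩
  · refine (OpBMO.starNorm_le_garsiaNorm (OpBMO.garsiaNorm_le_translateNorm hF hB)).trans ?_
    rw [← mul_assoc]
    exact OpBMO.coe_mul_le_coe_mul (by norm_num) B
  · exact OpBMO.translateNorm_le_garsiaNorm hF (OpBMO.garsiaNorm_le_starNorm hB)
  · refine (OpBMO.translateNorm_le_garsiaNorm hF hB).trans ?_
    simpa using OpBMO.coe_mul_le_coe_mul (show (1 : ℝ≥0) ≤ 32 by norm_num) B
  · exact (OpBMO.garsiaNorm_le_translateNorm hF hB).trans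
      (OpBMO.coe_mul_le_coe_mul (by norm_num) B)
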